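/- Let $H\in(3/4,1)$ and let $s_H(k)=\tfrac12\big(|k+1|^{2H}+|k-1|^{2H}-2|k|^{2H}\big)$, $k\in\mathbb Z$, be the correlation function of fractional noise. Let $X=\{X(h)\}$ be an isonormal process over a real Hilbert space $\mathfrak H$ (a centered Gaussian process with $\mathbb E[X(g)X(h)]=\langle g,h\rangle$), let $e_{ij}\in\mathfrak H$ satisfy $\langle e_{ij},e_{i'j'}\rangle=\mathbf 1_{\{i=i'\}}s_H(j-j')$, let $\mathcal X_{n,d}$ be the $n\times d$ random matrix with entries $X_{ij}=X(e_{ij})$, and set $$\widehat{\mathcal W}_{n,d}=d^{2-2H}\Big(\frac1d\,\mathcal X_{n,d}\mathcal X_{n,d}^T-I_n\Big).$$ Let $R_H(s,t)=\tfrac12(s^{2H}+t^{2H}-|t-s|^{2H})$ for $s,t\ge 0$, let $\mathfrak H_n$ be the Hilbert space obtained by completing the $\mathbb R^n$-valued step functions on $\mathbb R_+$ for the scalar product determined by $\langle \mathbf 1^{i}_{[0,s]},\mathbf 1^{j}_{[0,t]}\rangle=\mathbf 1_{\{i=j\}}R_H(s,t)$, where $\mathbf 1^{i}_{A}$ has $\mathbf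 1_A$ in position $i$ and $0$ elsewhere, and let $B$ be an isonormal process over $\mathfrak H_n$ (so that $(B(\mathbf 1^{i}_{[0,t]}))_{t\ge0}$, $1\le i\le n$, are independent fractional Brownian motions of Hurst index $H$). Let $I_2$ be the double Wiener–Itô integral with respect to $B$, that is, the continuous linear map $\mathfrak H_n^{\otimes2}\to L^2$ with $I_2(g\otimes h)=B(g)B(h)-\langle g,h\rangle$. For $1\le i,j\le n$ the kernels $$f_{ij}(d)=\frac d2\sum_{p=0}^{d-1}\Big\{\mathbf 1^{i}_{[\frac pd,\frac{p+1}d]}\otimes\mathbf 1^{j}_{[\frac pd,\frac{p+1}d]}+\mathbf 1^{j}_{[\frac pd,\frac{p+1}d]}\otimes\mathbf 1^{i}_{[\frac pd,\frac{p+1}d]}\Big\}$$ converge in $\mathfrak H_n^{\otimes 2}$ as $d\to\infty$ to a limit $g_{ij}$, and the $n\times n$ Rosenblatt–Wishart matrix is $\mathcal R_n^{(H)}=(I_2(g_{ij}))_{1\le i,j\le n}$. Then there is a finite constant $c_H>0$, depending only on $H$, such that for all $n,d\ge1$ $$d_{\rm Wass}\big(\widehat{\mathcal W}_{n,d},\mathcal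 R_n^{(H)}\big)\le c_H\,n\,d^{(3-4H)/2},$$ where $d_{\rm Wass}(\mathcal X,\mathcal Y)=\sup\{\mathbb E[g(\mathcal X)]-\mathbb E[g(\mathcal Y)]:\|g\|_{\rm Lip}\le1\}$, the Lipschitz constant of $g$ being taken for the Hilbert–Schmidt norm. In other words, $\widehat{\mathcal W}_{n,d}$ is $\phi$-close to $\mathcal R_n^{(H)}$ for $\phi(n,d)=n^2d^{3-4H}$: the Fortet–Mourier distance $\sup\{\mathbb E[g(\widehat{\mathcal W}_{n,d})]-\mathbb E[g(\mathcal R_n^{(H)})]:\|g\|_\infty+\|g\|_{\rm Lip}\le1\}$ tends to $0$ when $n,d\to\infty$ and $\phi(n,d)\to0$. -/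

import Mathlib

open Filter Topology MeasureTheory ProbabilityTheory
open scoped NNReal ENNReal TensorProduct InnerProductSpace

/-! ## Fractional Brownian motion: covariance and the associated Hilbert space -/

/-- Hurst indices: real numbers in the open interval `(0, 1)`. -/
abbrev HurstIndex : Type := Set.Ioo (0 : ℝ) 1

/-- The correlation function of fractional noise of Hurst index `H`. -/
noncomputable def noiseCorr (H : ℝ) (k : ℤ) : ℝ :=
  (|(k : ℝ) + 1| ^ (2 * H) + |(k : ℝ) - 1| ^ (2 * H) - 2 * |(k : ℝ)| ^ (2 * H)) / 2

/-- The covariance function `R_H(s, t)` of fractional Brownian motion. -/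
noncomputable def fbmCov (H : ℝ) (s t : ℝ≥0) : ℝ :=
  ((s : ℝ) ^ (2 * H) + (t : ℝ) ^ (2 * H) - |(t : ℝ) - s| ^ (2 * H)) / 2

section CovarianceNonneg

theorem oneSubCos_integrableOn (H : HurstIndex) (t : ℝ) :
    IntegrableOn (fun x : ℝ => (1 - Real.cos (t * x)) * x ^ (-1 - 2 * (H : ℝ)))
      (Set.Ioi 0) := by
  obtain ⟨h, h0, h1⟩ := H
  have hmeas : ∀ s : Set ℝ, AEStronglyMeasurable
      (fun x : ℝ => (1 - Real.cos (t * x)) * x ^ (-1 - 2 * h)) (volume.restrict s) := by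
    intro s
    apply Measurable.aestronglyMeasurable
    fun_prop
  rw [← Set.Ioc_union_Ioi_eq_Ioi (zero_le_one' ℝ)]
  refine IntegrableOn.union ?_ ?_
  · have hi : IntegrableOn (fun x : ℝ => t ^ 2 / 2 * x ^ (1 - 2 * h)) (Set.Ioc 0 1) := by
      have := intervalIntegral.intervalIntegrable_rpow' (a := 0) (b := 1) (r := 1 - 2 * h)
        (by linarith)
      rw [intervalIntegrable_iff_integrableOn_Ioc_of_le zero_le_one] at this
      exact this.const_mul _
    refine Integrable.mono' hi (hmeas _) ?_
    refine (ae_restrict_iff' measurableSet_Ioc).mpr (Eventually.of_forall fun x hx => ?_)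
    have hx0 : 0 < x := hx.1
    have hc := Real.one_sub_sq_div_two_le_cos (x := t * x)
    have hc' := Real.cos_le_one (t * x)
    rw [Real.norm_of_nonneg (mul_nonneg (by linarith) (Real.rpow_nonneg hx0.le _))]
    have e : x ^ (1 - 2 * h) = x ^ 2 * x ^ (-1 - 2 * h) := by
      rw [← Real.rpow_natCast, ← Real.rpow_add hx0]
      congr 1
      push_cast
      ring
    rw [e]
    have hp := Real.rpow_nonneg hx0.le (-1 - 2 * h)
    calc (1 - Real.cos (t * x)) * x ^ (-1 - 2 * h)
        ≤ ((t * x) ^ 2 / 2) * x ^ (-1 - 2 * h) := by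
          apply mul_le_mul_of_nonneg_right _ hp
          linarith
      _ = t ^ 2 / 2 * (x ^ 2 * x ^ (-1 - 2 * h)) := by ring
  · have hi : IntegrableOn (fun x : ℝ => 2 * x ^ (-1 - 2 * h)) (Set.Ioi 1) :=
      (integrableOn_Ioi_rpow_of_lt (by linarith) one_pos).const_mul _
    refine Integrable.mono' hi (hmeas _) ?_
    refine (ae_restrict_iff' measurableSet_Ioi).mpr (Eventually.of_forall fun x hx => ?_)
    have hx0 : 0 < x := one_pos.trans hx
    have hc := Real.neg_one_le_cos (t * x)
    have hc' := Real.cos_le_one (t * x)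
    rw [Real.norm_of_nonneg (mul_nonneg (by linarith) (Real.rpow_nonneg hx0.le _))]
    exact mul_le_mul_of_nonneg_right (by linarith) (Real.rpow_nonneg hx0.le _)

/-- The normalising constant in `|t|^{2H} = C⁻¹ ∫_0^∞ (1 - cos (t x)) x^{-1-2H} dx`. -/
noncomputable def oneSubCosConst (H : ℝ) : ℝ :=
  ∫ x in Set.Ioi (0 : ℝ), (1 - Real.cos x) * x ^ (-1 - 2 * H)

theorem oneSubCosConst_pos (H : HurstIndex) : 0 < oneSubCosConst H := by
  have hi := oneSubCos_integrableOn H 1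
  simp only [one_mul] at hi
  unfold oneSubCosConst
  rw [setIntegral_pos_iff_support_of_nonneg_ae _ hi]
  · refine lt_of_lt_of_le ?_ (measure_mono (μ := volume) (s := Set.Ioo 0 Real.pi) ?_)
    · simp [Real.pi_pos]
    · intro x hx
      refine ⟨?_, hx.1⟩
      have h1 : Real.cos x < 1 := by
        have := Real.cos_lt_cos_of_nonneg_of_le_pi le_rfl hx.2.le hx.1
        simpa using this
      exact mul_ne_zero (by linarith) (Real.rpow_pos_of_pos hx.1 _).ne'
  · refine (ae_restrict_iff' measurableSet_Ioi).mpr (Eventually.of_forall fun x hx => ?_)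
    have hc' := Real.cos_le_one x
    exact mul_nonneg (by linarith) (Real.rpow_nonneg (le_of_lt hx) _)

theorem integral_oneSubCos (H : HurstIndex) (t : ℝ) :
    ∫ x in Set.Ioi (0 : ℝ), (1 - Real.cos (t * x)) * x ^ (-1 - 2 * (H : ℝ)) =
      |t| ^ (2 * (H : ℝ)) * oneSubCosConst H := by
  have hcos : ∀ x, Real.cos (t * x) = Real.cos (|t| * x) := by
    intro x
    rcases abs_choice t with h | h <;> rw [h]
    rw [neg_mul, Real.cos_neg]
  simp only [hcos]
  have hH := H.2.1
  rcases (abs_nonneg t).eq_or_lt with h | h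
  · rw [← h]
    simp [Real.zero_rpow (by linarith : (2 * (H : ℝ)) ≠ 0)]
  · have key := integral_comp_mul_left_Ioi
      (fun y : ℝ => (1 - Real.cos y) * y ^ (-1 - 2 * (H : ℝ))) 0 h
    rw [mul_zero] at key
    have e : ∫ x in Set.Ioi (0 : ℝ), (1 - Real.cos (|t| * x)) * (|t| * x) ^ (-1 - 2 * (H : ℝ)) =
        |t| ^ (-1 - 2 * (H : ℝ)) *
          ∫ x in Set.Ioi (0 : ℝ), (1 - Real.cos (|t| * x)) * x ^ (-1 - 2 * (H : ℝ)) := by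
      rw [← integral_const_mul]
      refine setIntegral_congr_fun measurableSet_Ioi fun x hx => ?_
      rw [Real.mul_rpow h.le (le_of_lt hx)]
      ring
    rw [e, smul_eq_mul] at key
    have e2 : |t| ^ (-1 - 2 * (H : ℝ)) * |t| ^ (2 * (H : ℝ)) = |t|⁻¹ := by
      rw [← Real.rpow_add h, ← Real.rpow_neg_one]
      congr 1
      ring
    have hne : |t| ^ (-1 - 2 * (H : ℝ)) ≠ 0 := (Real.rpow_pos_of_pos h _).ne'
    apply mul_left_cancel₀ hne
    rw [key, ← mul_assoc, e2]
    rfl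

theorem fbmCov_eq_integral (H : HurstIndex) (s t : ℝ≥0) :
    2 * oneSubCosConst H * fbmCov H s t =
      ∫ x in Set.Ioi (0 : ℝ), ((1 - Real.cos (s * x)) * (1 - Real.cos (t * x)) +
        Real.sin (s * x) * Real.sin (t * x)) * x ^ (-1 - 2 * (H : ℝ)) := by
  have e : ∀ x : ℝ, ((1 - Real.cos (s * x)) * (1 - Real.cos (t * x)) +
        Real.sin (s * x) * Real.sin (t * x)) * x ^ (-1 - 2 * (H : ℝ)) =
      (1 - Real.cos (s * x)) * x ^ (-1 - 2 * (H : ℝ)) +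
      (1 - Real.cos (t * x)) * x ^ (-1 - 2 * (H : ℝ)) -
      (1 - Real.cos (((t : ℝ) - s) * x)) * x ^ (-1 - 2 * (H : ℝ)) := by
    intro x
    rw [sub_mul (t : ℝ) s x, Real.cos_sub]
    ring
  simp only [e]
  have i1 := oneSubCos_integrableOn H s
  have i2 := oneSubCos_integrableOn H t
  have i3 := oneSubCos_integrableOn H ((t : ℝ) - s)
  have i12 : IntegrableOn (fun x : ℝ => (1 - Real.cos (s * x)) * x ^ (-1 - 2 * (H : ℝ)) +
      (1 - Real.cos (t * x)) * x ^ (-1 - 2 * (H : ℝ))) (Set.Ioi 0) := i1.add i2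
  rw [integral_sub i12 i3, integral_add i1 i2]
  simp only [integral_oneSubCos, fbmCov, NNReal.abs_eq]
  ring

theorem fbmCov_integrableOn (H : HurstIndex) (s t : ℝ≥0) :
    IntegrableOn (fun x : ℝ => ((1 - Real.cos (s * x)) * (1 - Real.cos (t * x)) +
        Real.sin (s * x) * Real.sin (t * x)) * x ^ (-1 - 2 * (H : ℝ))) (Set.Ioi 0) := by
  have := ((oneSubCos_integrableOn H s).add (oneSubCos_integrableOn H t)).sub
    (oneSubCos_integrableOn H ((t : ℝ) - s))
  refine this.congr (Eventually.of_forall fun x => ?_)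
  simp only [Pi.add_apply, Pi.sub_apply]
  rw [sub_mul (t : ℝ) s x, Real.cos_sub]
  ring

theorem fbmCov_comm (H : ℝ) (s t : ℝ≥0) : fbmCov H s t = fbmCov H t s := by
  unfold fbmCov
  rw [abs_sub_comm]
  ring

theorem sum_fbmCov_nonneg (H : HurstIndex) {n : ℕ} (A : Finset (Fin n × ℝ≥0))
    (c : Fin n × ℝ≥0 → ℝ) :
    0 ≤ ∑ a ∈ A, ∑ b ∈ A, c a * c b * (if a.1 = b.1 then fbmCov H a.2 b.2 else 0) := by
  have hC := oneSubCosConst_pos H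
  refine nonneg_of_mul_nonneg_right (a := 2 * oneSubCosConst H) ?_ (by positivity)
  have e1 : 2 * oneSubCosConst H *
      ∑ a ∈ A, ∑ b ∈ A, c a * c b * (if a.1 = b.1 then fbmCov H a.2 b.2 else 0) =
      ∫ x in Set.Ioi (0 : ℝ), ∑ a ∈ A, ∑ b ∈ A, c a * c b * (if a.1 = b.1 then 1 else 0) *
        (((1 - Real.cos (a.2 * x)) * (1 - Real.cos (b.2 * x)) +
          Real.sin (a.2 * x) * Real.sin (b.2 * x)) * x ^ (-1 - 2 * (H : ℝ))) := by
    have hint : ∀ a b : Fin n × ℝ≥0, IntegrableOn (fun x : ℝ =>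
        c a * c b * (if a.1 = b.1 then 1 else 0) *
        (((1 - Real.cos (a.2 * x)) * (1 - Real.cos (b.2 * x)) +
          Real.sin (a.2 * x) * Real.sin (b.2 * x)) * x ^ (-1 - 2 * (H : ℝ)))) (Set.Ioi 0) :=
      fun a b => (fbmCov_integrableOn H a.2 b.2).const_mul _
    rw [integral_finsetSum _ fun a _ => integrable_finsetSum _ fun b _ => hint a b,
      Finset.mul_sum]
    refine Finset.sum_congr rfl fun a _ => ?_
    rw [integral_finsetSum _ fun b _ => hint a b, Finset.mul_sum]
    refine Finset.sum_congr rfl fun b _ => ?_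
    rw [integral_const_mul, ← fbmCov_eq_integral]
    split_ifs <;> ring
  rw [e1]
  refine setIntegral_nonneg measurableSet_Ioi fun x hx => ?_
  have hsq : ∀ u : Fin n × ℝ≥0 → ℝ,
      ∑ a ∈ A, ∑ b ∈ A, c a * c b * (if a.1 = b.1 then 1 else 0) * (u a * u b) =
      ∑ i : Fin n, (∑ a ∈ A, if a.1 = i then c a * u a else 0) ^ 2 := by
    intro u
    simp only [sq, Finset.sum_mul_sum]
    rw [Finset.sum_comm]
    rw [Finset.sum_comm]
    symm
    rw [Finset.sum_comm]
    refine Finset.sum_congr rfl fun a _ => ?_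
    rw [Finset.sum_comm]
    refine Finset.sum_congr rfl fun b _ => ?_
    rw [Finset.sum_eq_single a.1]
    · by_cases h : a.1 = b.1
      · simp only [h, if_true]
        ring
      · simp [h, Ne.symm h]
    · intro i _ hi
      simp [Ne.symm hi]
    · simp
  have e2 : ∑ a ∈ A, ∑ b ∈ A, c a * c b * (if a.1 = b.1 then 1 else 0) *
        (((1 - Real.cos (a.2 * x)) * (1 - Real.cos (b.2 * x)) +
          Real.sin (a.2 * x) * Real.sin (b.2 * x)) * x ^ (-1 - 2 * (H : ℝ))) =
      (∑ i : Fin n, (∑ a ∈ A, if a.1 = i then c a * (1 - Real.cos (a.2 * x)) else 0) ^ 2 +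
       ∑ i : Fin n, (∑ a ∈ A, if a.1 = i then c a * Real.sin (a.2 * x) else 0) ^ 2) *
        x ^ (-1 - 2 * (H : ℝ)) := by
    rw [← hsq (fun a => 1 - Real.cos (a.2 * x)), ← hsq (fun a => Real.sin (a.2 * x)),
      ← Finset.sum_add_distrib, Finset.sum_mul]
    refine Finset.sum_congr rfl fun a _ => ?_
    rw [← Finset.sum_add_distrib, Finset.sum_mul]
    refine Finset.sum_congr rfl fun b _ => ?_
    ring
  rw [e2]
  exact mul_nonneg (by positivity) (Real.rpow_nonneg (le_of_lt hx) _)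

end CovarianceNonneg

/-- Step functions on `ℝ₊` with values in `ℝⁿ`, written as finite linear combinations
`∑ c_{i,t} 1_{[0,t]}^{i}`, where `1_{[0,t]}^{i}` is the function with `1_{[0,t]}` in position `i`
and `0` in the other positions (these functions are linearly independent, so that such a
combination is the same thing as the function it represents). -/
def StepFun (_H : HurstIndex) (n : ℕ) : Type := (Fin n × ℝ≥0) →₀ ℝ

namespace StepFun

variable (H : HurstIndex) (n : ℕ)

noncomputable instance : AddCommGroup (StepFun H n) :=
  inferInstanceAs (AddCommGroup ((Fin n × ℝ≥0) →₀ ℝ))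

noncomputable instance : Module ℝ (StepFun H n) :=
  inferInstanceAs (Module ℝ ((Fin n × ℝ≥0) →₀ ℝ))

/-- The scalar product of step functions: the bilinear extension of
`⟨1_{[0,s]}^{i}, 1_{[0,t]}^{j}⟩ = δ_{ij} R_H(s, t)`. -/
noncomputable def form (f g : (Fin n × ℝ≥0) →₀ ℝ) : ℝ :=
  f.sum fun a u => g.sum fun b v => u * v * (if a.1 = b.1 then fbmCov H a.2 b.2 else 0)

theorem form_comm (f g : (Fin n × ℝ≥0) →₀ ℝ) : form H n f g = form H n g f := by
  unfold form
  rw [Finsupp.sum_comm]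
  refine Finsupp.sum_congr fun a _ => Finsupp.sum_congr fun b _ => ?_
  rw [fbmCov_comm, mul_comm (f b)]
  simp only [eq_comm]

/-- The pre-Hilbert structure on step functions. -/
@[reducible] noncomputable def core : PreInnerProductSpace.Core ℝ (StepFun H n) where
  inner f g := form H n f g
  conj_inner_symm f g := form_comm H n g f
  re_inner_nonneg f := sum_fbmCov_nonneg H (Finsupp.support f) (fun a => (show (Fin n × ℝ≥0) →₀ ℝ from f) a)
  add_left f g k := by
    refine Finsupp.sum_add_index' (by simp [Finsupp.sum]) fun a u v => ?_
    simp only [add_mul]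
    exact Finsupp.sum_add
  smul_left f g r := by
    refine (Finsupp.sum_smul_index (by simp [Finsupp.sum])).trans ?_
    simp only [conj_trivial]
    refine Eq.trans ?_ (Finsupp.mul_sum _ _).symm
    refine Finsupp.sum_congr fun a _ => ?_
    refine Eq.trans ?_ (Finsupp.mul_sum _ _).symm
    refine Finsupp.sum_congr fun b _ => ?_
    ring

noncomputable instance : SeminormedAddCommGroup (StepFun H n) :=
  @InnerProductSpace.Core.toSeminormedAddCommGroup ℝ (StepFun H n) _ _ _ (core H n)

noncomputable instance : InnerProductSpace ℝ (StepFun H n) :=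
  InnerProductSpace.ofCore (core H n)

/-- The step function `1_{[0,t]}^{i}`. -/
noncomputable def ind (i : Fin n) (t : ℝ≥0) : StepFun H n :=
  (Finsupp.single (i, t) 1 : (Fin n × ℝ≥0) →₀ ℝ)

theorem inner_ind (i j : Fin n) (s t : ℝ≥0) :
    ⟪ind H n i s, ind H n j t⟫_ℝ = if i = j then fbmCov H s t else 0 := by
  change form H n (Finsupp.single (i, s) 1) (Finsupp.single (j, t) 1) = _
  simp [form, Finsupp.sum_single_index]

end StepFun

/-- The Hilbert space of `n`-dimensional fractional Brownian motion of Hurst index `H`: the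
completion of the step functions (null vectors being identified with `0`). -/
abbrev FbmHilbert (H : HurstIndex) (n : ℕ) : Type := UniformSpace.Completion (StepFun H n)

/-- The element `1_{[a,b]}^{i}` of the Hilbert space, with `1_{[a,b]}` in position `i`. -/
noncomputable def FbmHilbert.ind (H : HurstIndex) (n : ℕ) (i : Fin n) (a b : ℝ≥0) :
    FbmHilbert H n :=
  ((StepFun.ind H n i b - StepFun.ind H n i a : StepFun H n) : UniformSpace.Completion _)

/-- The Hilbert tensor square of a real Hilbert space. -/
abbrev HilbertSq (E : Type*) [NormedAddCommGroup E] [InnerProductSpace ℝ E] : Type _ :=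
  UniformSpace.Completion (E ⊗[ℝ] E)

/-- The elementary tensor `g ⊗ h` in the Hilbert tensor square. -/
noncomputable def HilbertSq.tmul {E : Type*} [NormedAddCommGroup E] [InnerProductSpace ℝ E]
    (g h : E) : HilbertSq E :=
  ((g ⊗ₜ[ℝ] h : E ⊗[ℝ] E) : UniformSpace.Completion _)

/-! ## Isonormal processes and double Wiener-Itô integrals -/

/-- `X` is an isonormal process over `E`: a centered Gaussian process indexed by `E` with
`𝔼[X(g) X(h)] = ⟨g, h⟩`. -/
structure IsIsonormal {E : Type*} [NormedAddCommGroup E] [InnerProductSpace ℝ E]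
    {Ω : Type*} [MeasurableSpace Ω] (X : E → Ω → ℝ) (P : Measure Ω) : Prop where
  gaussian : IsGaussianProcess X P
  centered : ∀ h, ∫ ω, X h ω ∂P = 0
  covariance : ∀ g h, ∫ ω, X g ω * X h ω ∂P = ⟪g, h⟫_ℝ

theorem integral_pow_four_gaussianReal (v : ℝ≥0) :
    ∫ x, x ^ 4 ∂(gaussianReal 0 v) = 3 * (v : ℝ) ^ 2 := by
  have h : iteratedDeriv 4 (mgf (fun x ↦ x) (gaussianReal 0 v)) 0 = ∫ x, x ^ 4 ∂(gaussianReal 0 v) := by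
    rw [iteratedDeriv_mgf_zero] <;> simp
  rw [← h, mgf_fun_id_gaussianReal]
  simp only [zero_mul, zero_add]
  set w : ℝ := (v : ℝ)
  have d0 : ∀ t, HasDerivAt (fun t : ℝ ↦ Real.exp (w * t ^ 2 / 2))
      (w * t * Real.exp (w * t ^ 2 / 2)) t := by
    intro t
    have h1 : HasDerivAt (fun t : ℝ ↦ w * t ^ 2 / 2) (w * t) t := by
      have := ((hasDerivAt_pow 2 t).const_mul w).div_const 2
      refine this.congr_deriv ?_
      push_cast
      ring
    convert h1.exp using 1
    ring
  have d1 : deriv (fun t : ℝ ↦ Real.exp (w * t ^ 2 / 2)) =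
      fun t => w * t * Real.exp (w * t ^ 2 / 2) := funext fun t => (d0 t).deriv
  have d2 : deriv (fun t : ℝ ↦ w * t * Real.exp (w * t ^ 2 / 2)) =
      fun t => (w + w ^ 2 * t ^ 2) * Real.exp (w * t ^ 2 / 2) := by
    funext t
    have := (((hasDerivAt_id t).const_mul w).mul (d0 t)).deriv
    simp only [id] at this
    refine Eq.trans this ?_
    ring
  have d3 : deriv (fun t : ℝ ↦ (w + w ^ 2 * t ^ 2) * Real.exp (w * t ^ 2 / 2)) =
      fun t => (3 * w ^ 2 * t + w ^ 3 * t ^ 3) * Real.exp (w * t ^ 2 / 2) := by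
    funext t
    have := ((((hasDerivAt_pow 2 t).const_mul (w ^ 2)).const_add w).mul (d0 t)).deriv
    refine Eq.trans this ?_
    push_cast
    ring
  have d4 : deriv (fun t : ℝ ↦ (3 * w ^ 2 * t + w ^ 3 * t ^ 3) * Real.exp (w * t ^ 2 / 2)) 0 =
      3 * w ^ 2 := by
    have := ((((hasDerivAt_id (0 : ℝ)).const_mul (3 * w ^ 2)).add
      ((hasDerivAt_pow 3 (0 : ℝ)).const_mul (w ^ 3))).mul (d0 0)).deriv
    refine Eq.trans this ?_
    norm_num
  rw [iteratedDeriv_succ, iteratedDeriv_succ, iteratedDeriv_succ, iteratedDeriv_one, d1, d2, d3, d4]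

namespace IsIsonormal

variable {E : Type*} [NormedAddCommGroup E] [InnerProductSpace ℝ E]
  {Ω : Type*} [MeasurableSpace Ω] {X : E → Ω → ℝ} {P : Measure Ω}

theorem memLp (hX : IsIsonormal X P) (h : E) (p : ℝ≥0∞) (hp : p ≠ ∞) : MemLp (X h) p P :=
  (hX.gaussian.hasGaussianLaw_eval h).memLp hp

theorem integrable_mul (hX : IsIsonormal X P) (g h : E) :
    Integrable (fun ω => X g ω * X h ω) P :=
  (hX.memLp g 2 (by simp)).integrable_mul (hX.memLp h 2 (by simp))

theorem memLp_mul (hX : IsIsonormal X P) (g h : E) : MemLp (fun ω => X g ω * X h ω) 2 P :=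
  haveI : ENNReal.HolderTriple 4 4 2 := ⟨by
    rw [← ENNReal.toReal_eq_toReal_iff' (by simp) (by simp),
      ENNReal.toReal_add (by simp) (by simp)]
    norm_num⟩
  (hX.memLp h 4 (by simp)).mul (hX.memLp g 4 (by simp))

/-- A quadratic-mean criterion used to see that an isonormal process is linear. -/
theorem ae_eq_of_sq {f : Ω → ℝ} (hf : MemLp f 2 P)
    (h0 : ∫ ω, f ω ^ 2 ∂P = 0) : f =ᵐ[P] 0 := by
  have := (integral_eq_zero_iff_of_nonneg (fun ω => sq_nonneg (f ω)) hf.integrable_sq).1 h0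
  filter_upwards [this] with ω hω
  simpa using hω

theorem add_ae (hX : IsIsonormal X P) (g h : E) : X (g + h) =ᵐ[P] X g + X h := by
  have m := fun u => hX.memLp u 2 (by simp)
  have key := ae_eq_of_sq (f := fun ω => X (g + h) ω - X g ω - X h ω)
    (((m (g + h)).sub (m g)).sub (m h)) ?_
  · filter_upwards [key] with ω hω
    simp only [Pi.zero_apply, Pi.add_apply] at *
    linarith
  · have e : ∀ ω, (X (g + h) ω - X g ω - X h ω) ^ 2 =
        X (g + h) ω * X (g + h) ω + X g ω * X g ω + X h ω * X h ω
          - 2 * (X (g + h) ω * X g ω) - 2 * (X (g + h) ω * X h ω) + 2 * (X g ω * X h ω) := by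
      intro ω; ring
    simp only [e]
    have i := hX.integrable_mul
    rw [integral_add, integral_sub, integral_sub, integral_add, integral_add,
      integral_const_mul, integral_const_mul, integral_const_mul]
    · simp only [hX.covariance, inner_add_left, inner_add_right]
      rw [real_inner_comm g h]
      ring
    all_goals fun_prop

theorem smul_ae (hX : IsIsonormal X P) (c : ℝ) (g : E) : X (c • g) =ᵐ[P] c • X g := by
  have m := fun u => hX.memLp u 2 (by simp)
  have key := ae_eq_of_sq (f := fun ω => X (c • g) ω - c * X g ω)
    ((m (c • g)).sub ((m g).const_mul c)) ?_
  · filter_upwards [key] with ω hω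
    simp only [Pi.zero_apply, Pi.smul_apply, smul_eq_mul] at *
    linarith
  · have e : ∀ ω, (X (c • g) ω - c * X g ω) ^ 2 =
        X (c • g) ω * X (c • g) ω - (2 * c) * (X (c • g) ω * X g ω) +
          c ^ 2 * (X g ω * X g ω) := by
      intro ω; ring
    simp only [e]
    have i := hX.integrable_mul
    rw [integral_add, integral_sub, integral_const_mul, integral_const_mul]
    · simp only [hX.covariance, inner_smul_left, inner_smul_right, conj_trivial]
      ring
    all_goals fun_prop

theorem map_eq (hX : IsIsonormal X P) (h : E) :
    P.map (X h) = gaussianReal 0 (‖h‖ ^ 2).toNNReal := by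
  have := hX.gaussian.isProbabilityMeasure
  rw [(hX.gaussian.hasGaussianLaw_eval h).map_eq_gaussianReal, hX.centered,
    variance_of_integral_eq_zero (hX.gaussian.aemeasurable h) (hX.centered h)]
  congr 2
  simp only [sq]
  rw [hX.covariance, real_inner_self_eq_norm_mul_norm]

theorem integral_pow_four (hX : IsIsonormal X P) (h : E) :
    ∫ ω, X h ω ^ 4 ∂P = 3 * ⟪h, h⟫_ℝ ^ 2 := by
  have e := integral_map (μ := P) (hX.gaussian.aemeasurable h) (f := fun x : ℝ => x ^ 4)
    (by fun_prop)
  rw [hX.map_eq, integral_pow_four_gaussianReal, Real.coe_toNNReal _ (by positivity)] at e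
  rw [← e, real_inner_self_eq_norm_sq]

theorem integral_eight {f₁ f₂ f₃ f₄ f₅ f₆ f₇ f₈ : Ω → ℝ} (h₁ : Integrable f₁ P)
    (h₂ : Integrable f₂ P) (h₃ : Integrable f₃ P) (h₄ : Integrable f₄ P) (h₅ : Integrable f₅ P)
    (h₆ : Integrable f₆ P) (h₇ : Integrable f₇ P) (h₈ : Integrable f₈ P) :
    ∫ ω, (1 / 192) * (f₁ ω + f₂ ω + f₃ ω + f₄ ω - f₅ ω - f₆ ω - f₇ ω - f₈ ω) ∂P =
      (1 / 192) * (∫ ω, f₁ ω ∂P + ∫ ω, f₂ ω ∂P + ∫ ω, f₃ ω ∂P + ∫ ω, f₄ ω ∂P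
        - ∫ ω, f₅ ω ∂P - ∫ ω, f₆ ω ∂P - ∫ ω, f₇ ω ∂P - ∫ ω, f₈ ω ∂P) := by
  rw [integral_const_mul, integral_sub, integral_sub, integral_sub, integral_sub, integral_add,
    integral_add, integral_add]
  all_goals fun_prop

/-- Fourth joint moments of an isonormal process. -/
theorem integral_mul_mul (hX : IsIsonormal X P) (a b c d : E) :
    ∫ ω, (X a ω * X b ω) * (X c ω * X d ω) ∂P =
      ⟪a, b⟫_ℝ * ⟪c, d⟫_ℝ + ⟪a, c⟫_ℝ * ⟪b, d⟫_ℝ + ⟪a, d⟫_ℝ * ⟪b, c⟫_ℝ := by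
  have lin : ∀ p q r : ℝ, X (a + p • b + q • c + r • d) =ᵐ[P]
      fun ω => X a ω + p * X b ω + q * X c ω + r * X d ω := by
    intro p q r
    filter_upwards [hX.add_ae (a + p • b + q • c) (r • d), hX.add_ae (a + p • b) (q • c),
      hX.add_ae a (p • b), hX.smul_ae p b, hX.smul_ae q c, hX.smul_ae r d]
      with ω h1 h2 h3 h4 h5 h6
    simp only [Pi.add_apply, Pi.smul_apply, smul_eq_mul] at *
    rw [h1, h2, h3, h4, h5, h6]
  have int4 : ∀ h, Integrable (fun ω => X h ω ^ 4) P := by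
    intro h
    have := (hX.memLp h 4 (by simp)).integrable_norm_pow (by norm_num)
    refine this.congr (Eventually.of_forall fun ω => ?_)
    simp only [Real.norm_eq_abs]
    exact Even.pow_abs (by decide) _
  have val : ∀ p q r : ℝ, ∫ ω, (X a ω + p * X b ω + q * X c ω + r * X d ω) ^ 4 ∂P =
      3 * ⟪a + p • b + q • c + r • d, a + p • b + q • c + r • d⟫_ℝ ^ 2 := by
    intro p q r
    rw [← hX.integral_pow_four]
    refine integral_congr_ae ?_
    filter_upwards [lin p q r] with ω hω
    rw [hω]
  have int : ∀ p q r : ℝ,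
      Integrable (fun ω => (X a ω + p * X b ω + q * X c ω + r * X d ω) ^ 4) P := by
    intro p q r
    refine (int4 (a + p • b + q • c + r • d)).congr ?_
    filter_upwards [lin p q r] with ω hω
    rw [hω]
  have i1 := int 1 1 1
  have i2 := int 1 (-1) (-1)
  have i3 := int (-1) 1 (-1)
  have i4 := int (-1) (-1) 1
  have i5 := int (-1) (-1) (-1)
  have i6 := int (-1) 1 1
  have i7 := int 1 (-1) 1
  have i8 := int 1 1 (-1)
  have e : ∀ ω, (X a ω * X b ω) * (X c ω * X d ω) = (1 / 192) *
      ((X a ω + 1 * X b ω + 1 * X c ω + 1 * X d ω) ^ 4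
      + (X a ω + 1 * X b ω + (-1) * X c ω + (-1) * X d ω) ^ 4
      + (X a ω + (-1) * X b ω + 1 * X c ω + (-1) * X d ω) ^ 4
      + (X a ω + (-1) * X b ω + (-1) * X c ω + 1 * X d ω) ^ 4
      - (X a ω + (-1) * X b ω + (-1) * X c ω + (-1) * X d ω) ^ 4
      - (X a ω + (-1) * X b ω + 1 * X c ω + 1 * X d ω) ^ 4
      - (X a ω + 1 * X b ω + (-1) * X c ω + 1 * X d ω) ^ 4
      - (X a ω + 1 * X b ω + 1 * X c ω + (-1) * X d ω) ^ 4) := by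
    intro ω; ring
  simp only [e]
  rw [integral_eight i1 i2 i3 i4 i5 i6 i7 i8]
  simp only [val, inner_add_left, inner_add_right, inner_smul_left, inner_smul_right, conj_trivial]
  rw [real_inner_comm a b, real_inner_comm a c, real_inner_comm a d, real_inner_comm b c,
    real_inner_comm b d, real_inner_comm c d]
  ring

theorem memLp_wick (hX : IsIsonormal X P) (g h : E) :
    MemLp (fun ω => X g ω * X h ω - ⟪g, h⟫_ℝ) 2 P :=
  haveI := hX.gaussian.isProbabilityMeasure
  (hX.memLp_mul g h).sub (memLp_const _)

/-- The product `X(g) X(h) - ⟨g, h⟩ = I₂(g ⊗ h)`, an element of the second Wiener chaos, as a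
bilinear map. For a unit vector `h`, its value at `(h, h)` is `H₂(X(h)) = X(h)² - 1`. -/
noncomputable def wick (hX : IsIsonormal X P) : E →ₗ[ℝ] E →ₗ[ℝ] Lp ℝ 2 P :=
  LinearMap.mk₂ ℝ (fun g h => (hX.memLp_wick g h).toLp _)
    (fun g g' h => by
      rw [← MemLp.toLp_add]
      refine MemLp.toLp_congr _ _ ?_
      filter_upwards [hX.add_ae g g'] with ω hω
      simp only [Pi.add_apply] at *
      rw [hω, inner_add_left]
      ring)
    (fun c g h => by
      rw [← MemLp.toLp_const_smul]
      refine MemLp.toLp_congr _ _ ?_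
      filter_upwards [hX.smul_ae c g] with ω hω
      simp only [Pi.smul_apply, smul_eq_mul] at *
      rw [hω, inner_smul_left, conj_trivial]
      ring)
    (fun g h h' => by
      rw [← MemLp.toLp_add]
      refine MemLp.toLp_congr _ _ ?_
      filter_upwards [hX.add_ae h h'] with ω hω
      simp only [Pi.add_apply] at *
      rw [hω, inner_add_right]
      ring)
    (fun c g h => by
      rw [← MemLp.toLp_const_smul]
      refine MemLp.toLp_congr _ _ ?_
      filter_upwards [hX.smul_ae c h] with ω hω
      simp only [Pi.smul_apply, smul_eq_mul] at *
      rw [hω, inner_smul_right]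
      ring)

theorem wick_coe (hX : IsIsonormal X P) (g h : E) :
    hX.wick g h =ᵐ[P] fun ω => X g ω * X h ω - ⟪g, h⟫_ℝ :=
  (hX.memLp_wick g h).coeFn_toLp

theorem inner_wick (hX : IsIsonormal X P) (a b c d : E) :
    ⟪hX.wick a b, hX.wick c d⟫_ℝ = ⟪a, c⟫_ℝ * ⟪b, d⟫_ℝ + ⟪a, d⟫_ℝ * ⟪b, c⟫_ℝ := by
  have := hX.gaussian.isProbabilityMeasure
  rw [L2.inner_def]
  have e : ∫ ω, ⟪(hX.wick a b) ω, (hX.wick c d) ω⟫_ℝ ∂P =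
      ∫ ω, ((X a ω * X b ω) * (X c ω * X d ω) - ⟪c, d⟫_ℝ * (X a ω * X b ω)
        - ⟪a, b⟫_ℝ * (X c ω * X d ω) + ⟪a, b⟫_ℝ * ⟪c, d⟫_ℝ) ∂P := by
    refine integral_congr_ae ?_
    filter_upwards [hX.wick_coe a b, hX.wick_coe c d] with ω h1 h2
    rw [h1, h2]
    simp only [RCLike.inner_apply, conj_trivial]
    ring
  have i4 : Integrable (fun ω => (X a ω * X b ω) * (X c ω * X d ω)) P :=
    (hX.memLp_mul a b).integrable_mul (hX.memLp_mul c d)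
  have i := hX.integrable_mul
  rw [e, integral_add (by fun_prop) (by fun_prop), integral_sub (by fun_prop) (by fun_prop),
    integral_sub (by fun_prop) (by fun_prop), integral_const_mul, integral_const_mul,
    hX.integral_mul_mul, hX.covariance, hX.covariance]
  simp
  ring

/-- The double Wiener-Itô integral on the algebraic tensor square. -/
noncomputable def I2Alg (hX : IsIsonormal X P) : E ⊗[ℝ] E →ₗ[ℝ] Lp ℝ 2 P :=
  TensorProduct.lift hX.wick

theorem inner_I2Alg (hX : IsIsonormal X P) (s t : E ⊗[ℝ] E) :
    ⟪hX.I2Alg s, hX.I2Alg t⟫_ℝ = ⟪s, t⟫_ℝ + ⟪s, TensorProduct.comm ℝ E E t⟫_ℝ := by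
  induction s with
  | zero => simp
  | add s s' h h' =>
    simp only [map_add, inner_add_left, h, h']
    ring
  | tmul a b =>
    induction t with
    | zero => simp
    | add t t' h h' =>
      simp only [map_add, inner_add_right, h, h']
      ring
    | tmul c d => simp [I2Alg, inner_wick]

theorem norm_I2Alg_le (hX : IsIsonormal X P) (t : E ⊗[ℝ] E) :
    ‖hX.I2Alg t‖ ≤ √2 * ‖t‖ := by
  have h1 : ‖hX.I2Alg t‖ ^ 2 ≤ 2 * ‖t‖ ^ 2 := by
    have h2 : ⟪t, t⟫_ℝ = ‖t‖ ^ 2 := real_inner_self_eq_norm_sq t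
    rw [← real_inner_self_eq_norm_sq, inner_I2Alg, h2]
    have := real_inner_le_norm t (TensorProduct.comm ℝ E E t)
    rw [TensorProduct.norm_comm] at this
    nlinarith
  refine le_of_sq_le_sq ?_ (by positivity)
  rw [mul_pow, Real.sq_sqrt (by norm_num)]
  exact h1

/-- The double Wiener-Itô integral `I₂` with respect to the isonormal process `X`: the continuous
linear extension of `g ⊗ h ↦ X(g) X(h) - ⟨g, h⟩` to the Hilbert tensor square. It annihilates
antisymmetric tensors, and it satisfies `𝔼[I₂(f) I₂(f')] = 2 ⟨f, f'⟩` for symmetric `f`, `f'`. -/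
noncomputable def I2 (hX : IsIsonormal X P) : HilbertSq E →L[ℝ] Lp ℝ 2 P :=
  (hX.I2Alg.mkContinuous (√2) hX.norm_I2Alg_le).extend UniformSpace.Completion.toComplL

theorem I2_tmul (hX : IsIsonormal X P) (g h : E) :
    hX.I2 (HilbertSq.tmul g h) = hX.wick g h := by
  have := (hX.I2Alg.mkContinuous (√2) hX.norm_I2Alg_le).extend_eq
    (e := UniformSpace.Completion.toComplL)
    UniformSpace.Completion.denseRange_coe
    (UniformSpace.Completion.isUniformInducing_coe (E ⊗[ℝ] E)) (g ⊗ₜ[ℝ] h)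
  refine Eq.trans this ?_
  simp [I2Alg]

end IsIsonormal

/-! ## The Rosenblatt-Wishart matrix -/

/-- The approximating kernels
`(d/2) ∑_{p<d} (1^i_{[p/d,(p+1)/d]} ⊗ 1^j_{[p/d,(p+1)/d]} + 1^j_{[p/d,(p+1)/d]} ⊗ 1^i_{[p/d,(p+1)/d]})`. -/
noncomputable def rosenblattApprox (H : HurstIndex) (n : ℕ) (i j : Fin n) (d : ℕ) :
    HilbertSq (FbmHilbert H n) :=
  ((d : ℝ) / 2) • ∑ p ∈ Finset.range d,
    (HilbertSq.tmul
        (FbmHilbert.ind H n i ((p : ℝ≥0) / d) (((p : ℝ≥0) + 1) / d))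
        (FbmHilbert.ind H n j ((p : ℝ≥0) / d) (((p : ℝ≥0) + 1) / d)) +
      HilbertSq.tmul
        (FbmHilbert.ind H n j ((p : ℝ≥0) / d) (((p : ℝ≥0) + 1) / d))
        (FbmHilbert.ind H n i ((p : ℝ≥0) / d) (((p : ℝ≥0) + 1) / d)))

/-- The limit kernel `g_{ij}` of the approximating kernels. -/
noncomputable def rosenblattKernel (H : HurstIndex) (n : ℕ) (i j : Fin n) :
    HilbertSq (FbmHilbert H n) :=
  limUnder atTop (rosenblattApprox H n i j)

/-- The `n × n` Rosenblatt-Wishart matrix with Hurst parameter `H`, built on the isonormal process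
`B` of an `n`-dimensional fractional Brownian motion: its entries are `I₂(g_{ij})`. -/
noncomputable def rosenblattWishart {H : HurstIndex} {n : ℕ} {Ω : Type*} [MeasurableSpace Ω]
    {P : Measure Ω} {B : FbmHilbert H n → Ω → ℝ} (hB : IsIsonormal B P) (ω : Ω) :
    Matrix (Fin n) (Fin n) ℝ :=
  Matrix.of fun i j => hB.I2 (rosenblattKernel H n i j) ω

/-! ## Correlated Wishart matrices -/

/-- The family `e` has independent-row covariance structure with correlation function `s`:
`⟨e_{ij}, e_{i'j'}⟩ = 1_{i = i'} s(j - j')`. -/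
def HasCorrelation {E : Type*} [NormedAddCommGroup E] [InnerProductSpace ℝ E]
    (e : ℕ → ℕ → E) (s : ℤ → ℝ) : Prop :=
  ∀ i i' j j' : ℕ, ⟪e i j, e i' j'⟫_ℝ = if i = i' then s ((j : ℤ) - j') else 0

/-- The `n × d` data matrix with entries `X(e_{ij})` (indices start at `0`). -/
def dataMatrix {E Ω : Type*} (X : E → Ω → ℝ) (e : ℕ → ℕ → E) (n d : ℕ) (ω : Ω) :
    Matrix (Fin n) (Fin d) ℝ :=
  Matrix.of fun i j => X (e i j) ω

/-- The rescaled Wishart matrix `d^{2-2H} (d⁻¹ 𝒳 𝒳ᵀ - I)`. -/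
noncomputable def rescaledWishart (H : ℝ) {E Ω : Type*} (X : E → Ω → ℝ) (e : ℕ → ℕ → E)
    (n d : ℕ) (ω : Ω) : Matrix (Fin n) (Fin n) ℝ :=
  (d : ℝ) ^ (2 - 2 * H) •
    ((d : ℝ)⁻¹ • (dataMatrix X e n d ω * (dataMatrix X e n d ω).transpose) - 1)

/-! ## Distances between random matrices -/

/-- The Hilbert-Schmidt norm. -/
noncomputable def hsNorm {n : ℕ} (A : Matrix (Fin n) (Fin n) ℝ) : ℝ :=
  √(∑ i, ∑ j, A i j ^ 2)

/-- The supremum norm of a function on matrices. -/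
noncomputable def supNorm {n : ℕ} (g : Matrix (Fin n) (Fin n) ℝ → ℝ) : ℝ≥0∞ :=
  ⨆ A, ENNReal.ofReal |g A|

/-- The Lipschitz constant of a function on matrices, for the Hilbert-Schmidt norm. -/
noncomputable def lipNorm {n : ℕ} (g : Matrix (Fin n) (Fin n) ℝ → ℝ) : ℝ≥0∞ :=
  ⨆ (A : Matrix (Fin n) (Fin n) ℝ) (B : Matrix (Fin n) (Fin n) ℝ) (_ : A ≠ B),
    ENNReal.ofReal (|g A - g B| / hsNorm (A - B))

open Classical in
/-- The positive part of `𝔼[g(X)] - 𝔼[g(Y)]`, and `∞` if one of the expectations does not exist. -/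
noncomputable def expDiff {n : ℕ} {Ω Ω' : Type*} [MeasurableSpace Ω] [MeasurableSpace Ω']
    (P : Measure Ω) (X : Ω → Matrix (Fin n) (Fin n) ℝ)
    (P' : Measure Ω') (Y : Ω' → Matrix (Fin n) (Fin n) ℝ)
    (g : Matrix (Fin n) (Fin n) ℝ → ℝ) : ℝ≥0∞ :=
  if Integrable (fun ω => g (X ω)) P ∧ Integrable (fun ω => g (Y ω)) P' then
    ENNReal.ofReal (∫ ω, g (X ω) ∂P - ∫ ω, g (Y ω) ∂P')
  else ∞

/-- The Wasserstein distance between (the laws of) two random matrices. -/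
noncomputable def dWass {n : ℕ} {Ω Ω' : Type*} [MeasurableSpace Ω] [MeasurableSpace Ω']
    (P : Measure Ω) (X : Ω → Matrix (Fin n) (Fin n) ℝ)
    (P' : Measure Ω') (Y : Ω' → Matrix (Fin n) (Fin n) ℝ) : ℝ≥0∞ :=
  ⨆ (g : Matrix (Fin n) (Fin n) ℝ → ℝ) (_ : lipNorm g ≤ 1), expDiff P X P' Y g

/-- The Fortet-Mourier distance between (the laws of) two random matrices. -/
noncomputable def dFM {n : ℕ} {Ω Ω' : Type*} [MeasurableSpace Ω] [MeasurableSpace Ω']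
    (P : Measure Ω) (X : Ω → Matrix (Fin n) (Fin n) ℝ)
    (P' : Measure Ω') (Y : Ω' → Matrix (Fin n) (Fin n) ℝ) : ℝ≥0∞ :=
  ⨆ (g : Matrix (Fin n) (Fin n) ℝ → ℝ) (_ : supNorm g + lipNorm g ≤ 1), expDiff P X P' Y g

/-- `W_{n,d}` is `φ`-close to `Z_{n,d}`: their Fortet-Mourier distance tends to `0` when
`n, d → ∞` and `φ(n,d) → 0`. -/
def IsPhiClose (φ : ℕ → ℕ → ℝ≥0∞) {Ω Ω' : ℕ → ℕ → Type*}
    [∀ n d, MeasurableSpace (Ω n d)] [∀ n d, MeasurableSpace (Ω' n d)]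
    (P : ∀ n d, Measure (Ω n d)) (W : ∀ n d, Ω n d → Matrix (Fin n) (Fin n) ℝ)
    (P' : ∀ n d, Measure (Ω' n d)) (Z : ∀ n d, Ω' n d → Matrix (Fin n) (Fin n) ℝ) : Prop :=
  Tendsto (fun q : ℕ × ℕ => dFM (P q.1 q.2) (W q.1 q.2) (P' q.1 q.2) (Z q.1 q.2))
    ((atTop ×ˢ atTop) ⊓ comap (fun q : ℕ × ℕ => φ q.1 q.2) (𝓝 0)) (𝓝 0)

/-! ## The correlation function of fractional noise -/

/-! The proof is a coupling. Multiplied by d^H, the increments of B over the cells of length 1/d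
have the covariance of the data matrix, so they have its law (`map_dataMatrix_eq`). The rescaled
Wishart matrix built on them is almost surely the matrix of the I₂(f_ij(d)) (`wishartOf_cell_ae`).
The Wasserstein distance is therefore at most the L² norm of the matrix with entries I₂(f_ij(d) -
g_ij), that is √2 n times a uniform bound on ‖f_ij(d) - g_ij‖ (`integral_sub_integral_le`). What
remains is a deterministic rate d^{(3-4H)/2} for the kernels.

For that rate, the subdivision of step 1/d is compared with a refinement of step 1/(dm). Each coarse
cell is a sum of m fine ones, so f(d) - f(dm) is (d/2) times a sum over cells of "diagonal defects"
(∑ a_k)(∑ b_k) - m ∑ a_k b_k. Such a defect depends only on the differences a_k - a_l and b_k - b_l,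
so the inner product of two defects is a multiple of a sum of squared double increments of the
covariance (`inner_diagDefect`).

For equal or adjacent cells the increments are bounded crudely, by square sums of the correlation;
these grow like m^{4H-3} because H > 3/4. For distant cells each increment is controlled by the
oscillation of the correlation, which is antitone, and the squared oscillations add up by
telescoping. In both regimes the powers of m cancel and each row of inner products sums to
O(d^{-4H}), uniformly in m. Hence ‖f(d) - f(dm)‖² = O(d² · d · d^{-4H}). Two arbitrary subdivisions
are compared through the refinement dd', which gives the Cauchy property and the rate at once. -/

theorem noiseCorr_neg (H : ℝ) (k : ℤ) : noiseCorr H (-k) = noiseCorr H k := by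
  have h1 : |((-k : ℤ) : ℝ) + 1| = |(k : ℝ) - 1| := by
    rw [← abs_neg]; congr 1; push_cast; ring
  have h2 : |((-k : ℤ) : ℝ) - 1| = |(k : ℝ) + 1| := by
    rw [← abs_neg]; congr 1; push_cast; ring
  have h3 : |((-k : ℤ) : ℝ)| = |(k : ℝ)| := by push_cast; exact abs_neg _
  rw [noiseCorr, h1, h2, h3, noiseCorr]
  ring

theorem noiseCorr_natAbs (H : ℝ) (k : ℤ) : noiseCorr H (k.natAbs : ℤ) = noiseCorr H k := by
  rcases Int.natAbs_eq k with h | h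
  · rw [← h]
  · conv_rhs => rw [h, noiseCorr_neg]

theorem noiseCorr_zero (H : HurstIndex) : noiseCorr H 0 = 1 := by
  have h : 2 * (H : ℝ) ≠ 0 := by have := H.2.1; positivity
  simp [noiseCorr, Real.zero_rpow h]

theorem noiseCorr_natCast (H : ℝ) {k : ℕ} (hk : 1 ≤ k) :
    noiseCorr H (k : ℤ) =
      (((k : ℝ) + 1) ^ (2 * H) + ((k : ℝ) - 1) ^ (2 * H) - 2 * (k : ℝ) ^ (2 * H)) / 2 := by
  have h1 : (1 : ℝ) ≤ k := by exact_mod_cast hk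
  have e : ((k : ℤ) : ℝ) = k := by simp
  rw [noiseCorr, e, abs_of_nonneg (by linarith : (0 : ℝ) ≤ k + 1),
    abs_of_nonneg (by linarith : (0 : ℝ) ≤ (k : ℝ) - 1), abs_of_nonneg (by linarith : (0 : ℝ) ≤ k)]

/-- Factor out k^{2H} and put t = 1/k. Writing (1 ± t)^{2H} = (1 ± 2t + t²)^H, Bernoulli's
inequality for the exponent H ≤ 1 bounds each term; the linear parts cancel in the sum and leave 2H
t² ≤ 2t². -/
theorem noiseCorr_le_rpow (H : HurstIndex) {k : ℕ} (hk : 1 ≤ k) :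
    noiseCorr H (k : ℤ) ≤ (k : ℝ) ^ (2 * (H : ℝ) - 2) := by
  obtain ⟨h, h0, h1⟩ := H
  change noiseCorr h (k : ℤ) ≤ (k : ℝ) ^ (2 * h - 2)
  have hk1 : (1 : ℝ) ≤ k := by exact_mod_cast hk
  have hk0 : (0 : ℝ) < k := by linarith
  have ht1 : (k : ℝ)⁻¹ ≤ 1 := inv_le_one_of_one_le₀ hk1
  have ht0 : 0 < (k : ℝ)⁻¹ := inv_pos.2 hk0
  set t := (k : ℝ)⁻¹ with ht
  have key : ∀ s : ℝ, -1 ≤ s → (1 + s) ^ (2 * h) ≤ 1 + h * (2 * s + s ^ 2) := by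
    intro s hs
    have e : (1 + s) ^ (2 * h) = (1 + (2 * s + s ^ 2)) ^ h := by
      rw [Real.rpow_mul (by linarith)]
      congr 1
      rw [Real.rpow_two]
      ring
    rw [e]
    exact rpow_one_add_le_one_add_mul_self (by nlinarith [sq_nonneg (1 + s)]) h0.le h1.le
  have a1 := key t (by linarith)
  have a2 := key (-t) (by linarith)
  have e1 : ((k : ℝ) + 1) ^ (2 * h) = (k : ℝ) ^ (2 * h) * (1 + t) ^ (2 * h) := by
    rw [← Real.mul_rpow hk0.le (by linarith)]
    congr 1
    rw [ht]; field_simp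
  have e2 : ((k : ℝ) - 1) ^ (2 * h) = (k : ℝ) ^ (2 * h) * (1 + -t) ^ (2 * h) := by
    rw [← Real.mul_rpow hk0.le (by linarith)]
    congr 1
    rw [ht]; field_simp; ring
  have e3 : (k : ℝ) ^ (2 * h - 2) = (k : ℝ) ^ (2 * h) * t ^ 2 := by
    rw [Real.rpow_sub hk0, Real.rpow_two, ht, inv_pow, div_eq_mul_inv]
  rw [noiseCorr_natCast h hk, e1, e2, e3]
  have hp := Real.rpow_nonneg hk0.le (2 * h)
  have : (1 + t) ^ (2 * h) + (1 + -t) ^ (2 * h) - 2 ≤ 2 * t ^ 2 := by nlinarith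
  nlinarith

/-- Away from 0 this is midpoint convexity of x^{2H}, since 2H > 1. -/
theorem noiseCorr_nonneg (H : HurstIndex) (hH : 1 / 2 < (H : ℝ)) (k : ℤ) :
    0 ≤ noiseCorr H k := by
  rw [← noiseCorr_natAbs]
  rcases Nat.eq_zero_or_pos k.natAbs with h | h
  · rw [h]
    simp [noiseCorr_zero]
  · rw [noiseCorr_natCast _ h]
    set x : ℝ := (k.natAbs : ℝ)
    have hx : 1 ≤ x := by simp only [x]; exact_mod_cast h
    have := (convexOn_rpow (p := 2 * (H : ℝ)) (by linarith)).2
        (show x + 1 ∈ Set.Ici (0 : ℝ) by simp; linarith)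
        (show x - 1 ∈ Set.Ici (0 : ℝ) by simp; linarith)
        (show (0 : ℝ) ≤ 1 / 2 by norm_num) (show (0 : ℝ) ≤ 1 / 2 by norm_num) (by norm_num)
    simp only [smul_eq_mul] at this
    rw [show 1 / 2 * (x + 1) + 1 / 2 * (x - 1) = x by ring] at this
    linarith

/-- The derivative of the second difference of x^{2H} is 2H times the second difference of x^{2H-1},
which is nonpositive because x^{2H-1} is concave. -/
theorem antitone_noiseCorr (H : HurstIndex) (hH : 1 / 2 < (H : ℝ)) :
    Antitone fun k : ℕ => noiseCorr H (k : ℤ) := by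
  have hder : ∀ x : ℝ, 1 ≤ x → HasDerivAt (fun x : ℝ => (x + 1) ^ (2 * (H : ℝ)) +
      (x - 1) ^ (2 * (H : ℝ)) - 2 * x ^ (2 * (H : ℝ)))
      (2 * H * ((x + 1) ^ (2 * (H : ℝ) - 1) + (x - 1) ^ (2 * (H : ℝ) - 1)
        - 2 * x ^ (2 * (H : ℝ) - 1))) x := by
    intro x hx
    have d : ∀ c : ℝ, HasDerivAt (fun x : ℝ => (x + c) ^ (2 * (H : ℝ)))
        (2 * H * (x + c) ^ (2 * (H : ℝ) - 1)) x := by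
      intro c
      have := ((hasDerivAt_id x).add_const c).rpow_const (p := 2 * (H : ℝ))
        (Or.inr (by linarith))
      simpa using this
    have := ((d 1).add (d (-1))).sub ((d 0).const_mul 2)
    simp only [add_zero] at this
    refine (this.congr_deriv ?_)
    rw [← sub_eq_add_neg]
    ring
  have anti : AntitoneOn (fun x : ℝ => (x + 1) ^ (2 * (H : ℝ)) +
      (x - 1) ^ (2 * (H : ℝ)) - 2 * x ^ (2 * (H : ℝ))) (Set.Ici 1) := by
    refine antitoneOn_of_deriv_nonpos (convex_Ici 1)
      (fun x hx => (hder x hx).continuousAt.continuousWithinAt)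
      (fun x hx => ?_) (fun x hx => ?_)
    · rw [interior_Ici] at hx
      exact (hder x (le_of_lt hx)).differentiableAt.differentiableWithinAt
    · rw [interior_Ici] at hx
      have hx' : 1 < x := hx
      rw [(hder x hx'.le).deriv]
      have := (Real.concaveOn_rpow (p := 2 * (H : ℝ) - 1) (by linarith)
        (by linarith [H.2.2])).2
        (show x + 1 ∈ Set.Ici (0 : ℝ) by simp; linarith)
        (show x - 1 ∈ Set.Ici (0 : ℝ) by simp; linarith)
        (show (0 : ℝ) ≤ 1 / 2 by norm_num) (show (0 : ℝ) ≤ 1 / 2 by norm_num) (by norm_num)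
      simp only [smul_eq_mul] at this
      rw [show 1 / 2 * (x + 1) + 1 / 2 * (x - 1) = x by ring] at this
      exact mul_nonpos_of_nonneg_of_nonpos (by linarith) (by linarith)
  refine antitone_nat_of_succ_le fun k => ?_
  rcases Nat.eq_zero_or_pos k with rfl | hk
  -- The step from 0 to 1 escapes the derivative argument, since |k - 1| is not k - 1 at k = 0. The
  -- power bound at k = 1 gives the value at most 1 that is needed.
  · have := noiseCorr_le_rpow H le_rfl
    simpa [noiseCorr_zero] using this
  · rw [noiseCorr_natCast _ hk, noiseCorr_natCast _ (Nat.le_add_left 1 k)]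
    have hk1 : (1 : ℝ) ≤ k := by exact_mod_cast hk
    have := anti (a := (k : ℝ)) (b := ((k + 1 : ℕ) : ℝ)) hk1
      (by push_cast; simp) (by push_cast; linarith)
    simp only at this
    linarith

/-! ### Sums of squares of the correlation and of its increments -/

/-- A discrete comparison with the integral of x^q: Bernoulli's inequality with exponent q + 1 in
(0, 1] at s = -1/(m+1) gives (q+1)(m+1)^q ≤ (m+1)^{q+1} - m^{q+1}, which telescopes. -/
theorem sum_range_rpow_le {q : ℝ} (hq : -1 < q) (hq' : q ≤ 0) (m : ℕ) :
    ∑ k ∈ Finset.range m, ((k : ℝ) + 1) ^ q ≤ (q + 1)⁻¹ * (m : ℝ) ^ (q + 1) := by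
  have hq0 : 0 < q + 1 := by linarith
  induction m with
  | zero => simp [Real.zero_rpow hq0.ne']
  | succ m ih =>
    rw [Finset.sum_range_succ]
    have hm : (0 : ℝ) < (m : ℝ) + 1 := by positivity
    have hb := rpow_one_add_le_one_add_mul_self (s := -((m : ℝ) + 1)⁻¹) (p := q + 1)
      (by rw [neg_le_neg_iff]; exact inv_le_one_of_one_le₀ (by simp)) hq0.le (by linarith)
    have e1 : (m : ℝ) ^ (q + 1) = ((m : ℝ) + 1) ^ (q + 1) * (1 + -((m : ℝ) + 1)⁻¹) ^ (q + 1) := by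
      rw [← Real.mul_rpow hm.le]
      · congr 1
        field_simp
        ring
      · rw [← sub_eq_add_neg, sub_nonneg]
        exact inv_le_one_of_one_le₀ (by simp)
    have e2 : ((m : ℝ) + 1) ^ (q + 1) * ((m : ℝ) + 1)⁻¹ = ((m : ℝ) + 1) ^ q := by
      rw [Real.rpow_add hm, Real.rpow_one, mul_assoc, mul_inv_cancel₀ hm.ne', mul_one]
    have hp := Real.rpow_nonneg hm.le (q + 1)
    have h3 : (m : ℝ) ^ (q + 1) ≤ ((m : ℝ) + 1) ^ (q + 1) - (q + 1) * ((m : ℝ) + 1) ^ q := by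
      rw [e1, ← e2]
      nlinarith
    have h4 : (q + 1)⁻¹ * (m : ℝ) ^ (q + 1) ≤
        (q + 1)⁻¹ * ((m : ℝ) + 1) ^ (q + 1) - ((m : ℝ) + 1) ^ q := by
      calc _ ≤ (q + 1)⁻¹ * (((m : ℝ) + 1) ^ (q + 1) - (q + 1) * ((m : ℝ) + 1) ^ q) := by gcongr
        _ = _ := by field_simp
    push_cast
    linarith

/-- The squares decay at least as fast as k^{4H-4}, an exponent above -1 exactly when H > 3/4. The
term k = 0 equals 1 and is absorbed by m^{4H-3} ≥ 1. -/
theorem sum_noiseCorr_sq_le (H : HurstIndex) (hH : 3 / 4 < (H : ℝ)) {m : ℕ} (hm : 1 ≤ m) :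
    ∑ k ∈ Finset.range m, noiseCorr H (k : ℤ) ^ 2 ≤
      (1 + (4 * (H : ℝ) - 3)⁻¹) * (m : ℝ) ^ (4 * (H : ℝ) - 3) := by
  have hm1 : (1 : ℝ) ≤ m := by exact_mod_cast hm
  have h1 : ∑ k ∈ Finset.range m, noiseCorr H ((k + 1 : ℕ) : ℤ) ^ 2 ≤
      (4 * (H : ℝ) - 3)⁻¹ * (m : ℝ) ^ (4 * (H : ℝ) - 3) := by
    have := sum_range_rpow_le (q := 4 * (H : ℝ) - 4) (by linarith) (by linarith [H.2.2]) m
    rw [show 4 * (H : ℝ) - 4 + 1 = 4 * H - 3 by ring] at this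
    refine le_trans (Finset.sum_le_sum fun k _ => ?_) this
    have h2 := noiseCorr_le_rpow H (k := k + 1) (by omega)
    have h3 := noiseCorr_nonneg H (by linarith) ((k + 1 : ℕ) : ℤ)
    calc noiseCorr H ((k + 1 : ℕ) : ℤ) ^ 2
        ≤ (((k + 1 : ℕ) : ℝ) ^ (2 * (H : ℝ) - 2)) ^ 2 := by gcongr
      _ = ((k : ℝ) + 1) ^ (4 * (H : ℝ) - 4) := by
        rw [← Real.rpow_natCast, ← Real.rpow_mul (by positivity)]
        push_cast
        ring_nf
  have h2 : (1 : ℝ) ≤ (m : ℝ) ^ (4 * (H : ℝ) - 3) := Real.one_le_rpow hm1 (by linarith)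
  calc _ ≤ ∑ k ∈ Finset.range (m + 1), noiseCorr H (k : ℤ) ^ 2 :=
        Finset.sum_le_sum_of_subset_of_nonneg (Finset.range_mono (by omega))
          fun _ _ _ => sq_nonneg _
    _ ≤ (4 * (H : ℝ) - 3)⁻¹ * (m : ℝ) ^ (4 * (H : ℝ) - 3) + 1 := by
        rw [Finset.sum_range_succ']
        simpa [noiseCorr_zero] using h1
    _ ≤ _ := by linarith

/-- Summation over a Toeplitz array is dominated by summation over one side of the diagonal. -/
theorem sum_sum_natAbs_sub_le (w : ℕ → ℝ) (hw : ∀ r, 0 ≤ w r) (d : ℕ) :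
    ∑ p ∈ Finset.range d, ∑ q ∈ Finset.range d, w ((p : ℤ) - q).natAbs ≤
      2 * d * ∑ r ∈ Finset.range d, w r := by
  have h : ∀ p ∈ Finset.range d, ∑ q ∈ Finset.range d, w ((p : ℤ) - q).natAbs ≤
      2 * ∑ r ∈ Finset.range d, w r := by
    intro p hp
    rw [Finset.mem_range] at hp
    -- On each side of the diagonal q ↦ |p - q| is injective with values in `range d`, so each
    -- half-row is a subsum of ∑ w.
    rw [← Finset.sum_filter_add_sum_filter_not (Finset.range d) (fun q => q ≤ p), two_mul]
    refine add_le_add ?_ ?_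
    · rw [← Finset.sum_image (s := (Finset.range d).filter (fun q => q ≤ p))
        (g := fun q : ℕ => ((p : ℤ) - q).natAbs) (f := w)]
      · refine Finset.sum_le_sum_of_subset_of_nonneg (fun r hr => ?_) fun r _ _ => hw r
        simp only [Finset.mem_image, Finset.mem_filter, Finset.mem_range] at hr ⊢
        omega
      · intro a ha b hb hab
        simp only [Finset.coe_filter, Finset.mem_range, Set.mem_ofPred_eq] at ha hb hab
        omega
    · rw [← Finset.sum_image (s := (Finset.range d).filter (fun q => ¬ q ≤ p))
        (g := fun q : ℕ => ((p : ℤ) - q).natAbs) (f := w)]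
      · refine Finset.sum_le_sum_of_subset_of_nonneg (fun r hr => ?_) fun r _ _ => hw r
        simp only [Finset.mem_image, Finset.mem_filter, Finset.mem_range] at hr ⊢
        omega
      · intro a ha b hb hab
        simp only [Finset.coe_filter, Finset.mem_range, Set.mem_ofPred_eq] at ha hb hab
        omega
  refine (Finset.sum_le_sum h).trans (le_of_eq ?_)
  simp
  ring

/-- Each difference lies between 0 and σ m, so the sum of squares is at most σ m times the sum of
the differences. That sum telescopes with lag two and is at most σ m + σ (2m) ≤ 2 σ m. -/
theorem sum_sq_sub_le_of_antitone {σ : ℕ → ℝ} (hσ : Antitone σ) (h0 : ∀ k, 0 ≤ σ k) (m N : ℕ) :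
    ∑ r ∈ Finset.range N, (σ ((r + 1) * m) - σ ((r + 3) * m)) ^ 2 ≤ 2 * σ m ^ 2 := by
  have tel : ∀ N, ∑ r ∈ Finset.range N, (σ ((r + 1) * m) - σ ((r + 3) * m)) =
      σ m + σ (2 * m) - σ ((N + 1) * m) - σ ((N + 2) * m) := by
    intro N
    induction N with
    | zero => simp
    | succ N ih =>
      rw [Finset.sum_range_succ, ih]
      ring_nf
  have h1 : ∀ r, 0 ≤ σ ((r + 1) * m) - σ ((r + 3) * m) := fun r =>
    sub_nonneg.2 (hσ (Nat.mul_le_mul_right _ (by omega)))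
  have h2 : ∀ r, σ ((r + 1) * m) - σ ((r + 3) * m) ≤ σ m := fun r => by
    have := hσ (Nat.le_mul_of_pos_left m (show 0 < r + 1 by omega))
    have := h0 ((r + 3) * m)
    linarith
  calc _ ≤ ∑ r ∈ Finset.range N, σ m * (σ ((r + 1) * m) - σ ((r + 3) * m)) := by
        refine Finset.sum_le_sum fun r _ => ?_
        rw [sq]
        exact mul_le_mul_of_nonneg_right (h2 r) (h1 r)
    _ ≤ σ m * (2 * σ m) := by
        rw [← Finset.mul_sum, tel]
        refine mul_le_mul_of_nonneg_left ?_ (h0 _)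
        have := hσ (show m ≤ 2 * m by omega)
        have := h0 ((N + 1) * m)
        have := h0 ((N + 2) * m)
        linarith
    _ = _ := by ring

/-! ## Symmetric tensors and diagonal defects -/

namespace HilbertSq

variable {E : Type*} [NormedAddCommGroup E] [InnerProductSpace ℝ E]

/-- The symmetrised elementary tensor `a ⊗ b + b ⊗ a`, as a bilinear map. -/
noncomputable def symTmul : E →ₗ[ℝ] E →ₗ[ℝ] HilbertSq E :=
  LinearMap.mk₂ ℝ (fun a b => tmul a b + tmul b a)
    (fun a a' b => by
      simp only [tmul, ← UniformSpace.Completion.coe_add, TensorProduct.add_tmul,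
        TensorProduct.tmul_add]
      congr 1
      abel)
    (fun c a b => by
      simp only [tmul, ← UniformSpace.Completion.coe_add, ← UniformSpace.Completion.coe_smul,
        TensorProduct.smul_tmul', TensorProduct.tmul_smul, smul_add])
    (fun a b b' => by
      simp only [tmul, ← UniformSpace.Completion.coe_add, TensorProduct.add_tmul,
        TensorProduct.tmul_add]
      congr 1
      abel)
    (fun c a b => by
      simp only [tmul, ← UniformSpace.Completion.coe_add, ← UniformSpace.Completion.coe_smul,
        TensorProduct.smul_tmul', TensorProduct.tmul_smul, smul_add])

theorem symTmul_apply (a b : E) : symTmul a b = tmul a b + tmul b a := rfl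

theorem inner_tmul (a b c d : E) : ⟪tmul a b, tmul c d⟫_ℝ = ⟪a, c⟫_ℝ * ⟪b, d⟫_ℝ := by
  rw [tmul, tmul, UniformSpace.Completion.inner_coe, TensorProduct.inner_tmul]

theorem inner_symTmul (a b c d : E) :
    ⟪symTmul a b, symTmul c d⟫_ℝ =
      2 * (⟪a, c⟫_ℝ * ⟪b, d⟫_ℝ + ⟪a, d⟫_ℝ * ⟪b, c⟫_ℝ) := by
  simp only [symTmul_apply, inner_add_left, inner_add_right, inner_tmul]
  ring

/-- The defect made by restricting the symmetric tensor `(∑ aₖ) ⊗ (∑ bₖ)` to its diagonal and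
multiplying by the number of terms. -/
noncomputable def diagDefect (m : ℕ) (a b : ℕ → E) : HilbertSq E :=
  symTmul (∑ k ∈ Finset.range m, a k) (∑ k ∈ Finset.range m, b k) -
    (m : ℝ) • ∑ k ∈ Finset.range m, symTmul (a k) (b k)

/-- In the double sum of the symmetrised products of differences, the terms of equal index
contribute 2m times the diagonal and the cross terms -2 times the full product. Adding a common
vector to all a_k or to all b_k thus has no effect, which is what makes distant defects nearly
orthogonal. -/
theorem diagDefect_eq (m : ℕ) (a b : ℕ → E) :
    diagDefect m a b = (-(1 / 2) : ℝ) • ∑ k ∈ Finset.range m, ∑ l ∈ Finset.range m,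
      symTmul (a k - a l) (b k - b l) := by
  have e : ∑ k ∈ Finset.range m, ∑ l ∈ Finset.range m, symTmul (a k - a l) (b k - b l) =
      (2 : ℝ) • ((m : ℝ) • ∑ k ∈ Finset.range m, symTmul (a k) (b k) -
        symTmul (∑ k ∈ Finset.range m, a k) (∑ k ∈ Finset.range m, b k)) := by
    simp only [map_sub, LinearMap.sub_apply, Finset.sum_sub_distrib, Finset.sum_const,
      Finset.card_range, map_sum, LinearMap.sum_apply, ← Nat.cast_smul_eq_nsmul ℝ,
      ← Finset.smul_sum]
    rw [Finset.sum_comm (f := fun k l => symTmul (a l) (b k)), two_smul]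
    abel
  rw [e, smul_smul, diagDefect]
  norm_num

/-- Double increments of a function of two indices. -/
def doubleIncr (x : ℕ → ℕ → ℝ) (k l k' l' : ℕ) : ℝ := x k k' - x l k' - x k l' + x l l'

/-- The parameter δ treats diagonal entries (δ = 1) and off-diagonal entries (δ = 0) together. The
direct pairing of differences gives the square of a double increment and the crossed pairing δ²
times the same square. The factor is (1/2)² · 2(1 + δ²). -/
theorem inner_diagDefect {m : ℕ} {a b c e : ℕ → E} {x : ℕ → ℕ → ℝ} {δ : ℝ}
    (h1 : ∀ k l, ⟪a k, c l⟫_ℝ = x k l) (h2 : ∀ k l, ⟪b k, e l⟫_ℝ = x k l)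
    (h3 : ∀ k l, ⟪a k, e l⟫_ℝ = δ * x k l) (h4 : ∀ k l, ⟪b k, c l⟫_ℝ = δ * x k l) :
    ⟪diagDefect m a b, diagDefect m c e⟫_ℝ = (1 + δ ^ 2) / 2 *
      ∑ k ∈ Finset.range m, ∑ l ∈ Finset.range m, ∑ k' ∈ Finset.range m, ∑ l' ∈ Finset.range m,
        doubleIncr x k l k' l' ^ 2 := by
  simp only [diagDefect_eq, inner_smul_left, inner_smul_right, sum_inner]
  simp only [inner_sum, Finset.mul_sum, inner_symTmul, inner_sub_left, inner_sub_right, h1, h2, h3, h4, conj_trivial,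
    doubleIncr]
  refine Finset.sum_congr rfl fun k _ => Finset.sum_congr rfl fun l _ =>
    Finset.sum_congr rfl fun k' _ => Finset.sum_congr rfl fun l' _ => ?_
  ring

theorem sum_doubleIncr_sq_nonneg (m : ℕ) (x : ℕ → ℕ → ℝ) :
    0 ≤ ∑ k ∈ Finset.range m, ∑ l ∈ Finset.range m, ∑ k' ∈ Finset.range m,
      ∑ l' ∈ Finset.range m, doubleIncr x k l k' l' ^ 2 :=
  Finset.sum_nonneg fun _ _ => Finset.sum_nonneg fun _ _ => Finset.sum_nonneg fun _ _ =>
    Finset.sum_nonneg fun _ _ => sq_nonneg _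

/-- The crude bound for nearby cells: (u - v - w + z)² ≤ 4(u² + v² + w² + z²), and each of the four
squares leaves two of the four indices free. -/
theorem sum_doubleIncr_sq_le (m : ℕ) (x : ℕ → ℕ → ℝ) :
    ∑ k ∈ Finset.range m, ∑ l ∈ Finset.range m, ∑ k' ∈ Finset.range m, ∑ l' ∈ Finset.range m,
        doubleIncr x k l k' l' ^ 2 ≤
      16 * (m : ℝ) ^ 2 * ∑ k ∈ Finset.range m, ∑ l ∈ Finset.range m, x k l ^ 2 := by
  calc _ ≤ ∑ k ∈ Finset.range m, ∑ l ∈ Finset.range m, ∑ k' ∈ Finset.range m,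
        ∑ l' ∈ Finset.range m,
          4 * (x k k' ^ 2 + x l k' ^ 2 + x k l' ^ 2 + x l l' ^ 2) := by
        refine Finset.sum_le_sum fun k _ => Finset.sum_le_sum fun l _ =>
          Finset.sum_le_sum fun k' _ => Finset.sum_le_sum fun l' _ => ?_
        rw [doubleIncr]
        nlinarith [sq_nonneg (x k k' + x l k'), sq_nonneg (x k k' + x k l'),
          sq_nonneg (x k k' - x l l'), sq_nonneg (x l k' - x k l'),
          sq_nonneg (x l k' + x l l'), sq_nonneg (x k l' + x l l')]
    _ = _ := by
        simp only [← Finset.mul_sum, Finset.sum_add_distrib, Finset.sum_const, Finset.card_range,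
          nsmul_eq_mul]
        ring

/-- The bound for distant cells: only the oscillation β - α of the covariance enters, not its size.
-/
theorem sum_doubleIncr_sq_le_of_mem_Icc {m : ℕ} {x : ℕ → ℕ → ℝ} {α β : ℝ}
    (hx : ∀ k < m, ∀ l < m, x k l ∈ Set.Icc α β) :
    ∑ k ∈ Finset.range m, ∑ l ∈ Finset.range m, ∑ k' ∈ Finset.range m, ∑ l' ∈ Finset.range m,
        doubleIncr x k l k' l' ^ 2 ≤ 4 * (m : ℝ) ^ 4 * (β - α) ^ 2 := by
  calc _ ≤ ∑ k ∈ Finset.range m, ∑ l ∈ Finset.range m, ∑ k' ∈ Finset.range m,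
        ∑ l' ∈ Finset.range m, (2 * (β - α)) ^ 2 := by
        refine Finset.sum_le_sum fun k hk => Finset.sum_le_sum fun l hl =>
          Finset.sum_le_sum fun k' hk' => Finset.sum_le_sum fun l' hl' => ?_
        rw [Finset.mem_range] at hk hl hk' hl'
        have h1 := hx k hk k' hk'
        have h2 := hx l hl k' hk'
        have h3 := hx k hk l' hl'
        have h4 := hx l hl l' hl'
        rw [doubleIncr]
        exact sq_le_sq' (by linarith [h1.1, h2.2, h3.2, h4.1]) (by linarith [h1.2, h2.1, h3.1, h4.2])
    _ = _ := by
        simp only [Finset.sum_const, Finset.card_range, nsmul_eq_mul]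
        ring

end HilbertSq

/-! ## Indicators of the cells of a regular subdivision -/

namespace FbmHilbert

variable (H : HurstIndex) (n : ℕ)

/-- The element `1_{[p/d,(p+1)/d]}^{i}` of the Hilbert space. -/
noncomputable def cell (d : ℕ) (i : Fin n) (p : ℕ) : FbmHilbert H n :=
  ind H n i ((p : ℝ≥0) / d) (((p : ℝ≥0) + 1) / d)

/-- Stationarity and self-similarity of the increments: the one-variable powers cancel in the double
difference of R_H, and homogeneity extracts d^{-2H}. -/
theorem inner_cell {d : ℕ} (hd : 1 ≤ d) (i j : Fin n) (p q : ℕ) :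
    ⟪cell H n d i p, cell H n d j q⟫_ℝ =
      if i = j then ((d : ℝ) ^ (2 * (H : ℝ)))⁻¹ * noiseCorr H ((p : ℤ) - q) else 0 := by
  have hd0 : (0 : ℝ) < d := by exact_mod_cast hd
  rw [cell, cell, ind, ind, UniformSpace.Completion.inner_coe]
  simp only [inner_sub_left, inner_sub_right, StepFun.inner_ind]
  by_cases hij : i = j
  · simp only [hij, if_true, fbmCov]
    push_cast
    have e : ∀ s t : ℝ, |s / d - t / d| ^ (2 * (H : ℝ)) =
        ((d : ℝ) ^ (2 * (H : ℝ)))⁻¹ * |t - s| ^ (2 * (H : ℝ)) := by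
      intro s t
      rw [← sub_div, abs_div, abs_of_pos hd0, Real.div_rpow (abs_nonneg _) hd0.le, abs_sub_comm,
        div_eq_inv_mul]
    simp only [e, noiseCorr]
    push_cast
    rw [show (p : ℝ) + 1 - (q + 1) = p - q by ring, show (p : ℝ) + 1 - q = p - q + 1 by ring,
      show (p : ℝ) - (q + 1) = p - q - 1 by ring]
    ring
  · simp [hij]

theorem cell_eq_sum {d m : ℕ} (hd : 1 ≤ d) (hm : 1 ≤ m) (i : Fin n) (p : ℕ) :
    cell H n d i p = ∑ k ∈ Finset.range m, cell H n (d * m) i (p * m + k) := by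
  have hd0 : (d : ℝ≥0) ≠ 0 := by positivity
  have hm0 : (m : ℝ≥0) ≠ 0 := by positivity
  have := Finset.sum_range_sub (fun k : ℕ => ((StepFun.ind H n i
    ((((p * m + k : ℕ) : ℝ≥0)) / ((d * m : ℕ) : ℝ≥0)) : StepFun H n) :
      UniformSpace.Completion (StepFun H n))) m
  have e1 : (((p * m + m : ℕ) : ℝ≥0)) / ((d * m : ℕ) : ℝ≥0) = ((p : ℝ≥0) + 1) / d := by
    push_cast
    field_simp
  have e0 : (((p * m + 0 : ℕ) : ℝ≥0)) / ((d * m : ℕ) : ℝ≥0) = (p : ℝ≥0) / d := by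
    push_cast
    field_simp
    simp
  simp only [e1, e0, ← UniformSpace.Completion.coe_sub] at this
  rw [cell, ind, ← this]
  refine Finset.sum_congr rfl fun k _ => ?_
  rw [cell, ind]
  push_cast
  simp only [add_assoc]

end FbmHilbert

/-! ## Convergence of the kernels -/

section Convergence

variable (H : HurstIndex) (n : ℕ)

open FbmHilbert HilbertSq

theorem rosenblattApprox_eq (i j : Fin n) (d : ℕ) :
    rosenblattApprox H n i j d =
      ((d : ℝ) / 2) • ∑ p ∈ Finset.range d, symTmul (cell H n d i p) (cell H n d j p) := rfl

/-- The diagonal defect of the cell `p` of the subdivision of step `1/d`, cut in `m` cells. -/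
noncomputable def cellDefect (d m : ℕ) (i j : Fin n) (p : ℕ) : HilbertSq (FbmHilbert H n) :=
  diagDefect m (fun k => cell H n (d * m) i (p * m + k)) fun k => cell H n (d * m) j (p * m + k)

theorem sum_range_mul {M : Type*} [AddCommMonoid M] (f : ℕ → M) (d m : ℕ) :
    ∑ k ∈ Finset.range (d * m), f k =
      ∑ p ∈ Finset.range d, ∑ k ∈ Finset.range m, f (p * m + k) := by
  induction d with
  | zero => simp
  | succ d ih => rw [Nat.succ_mul, Finset.sum_range_add, ih, Finset.sum_range_succ]

/-- On each coarse cell f(d) carries the full product of two sums of m fine cells, whereas f(dm)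
keeps only its diagonal, with a weight m times larger. -/
theorem rosenblattApprox_sub {d m : ℕ} (hd : 1 ≤ d) (hm : 1 ≤ m) (i j : Fin n) :
    rosenblattApprox H n i j d - rosenblattApprox H n i j (d * m) =
      ((d : ℝ) / 2) • ∑ p ∈ Finset.range d, cellDefect H n d m i j p := by
  simp only [rosenblattApprox_eq, cellDefect, diagDefect, ← cell_eq_sum H n hd hm]
  rw [Finset.sum_sub_distrib, smul_sub, sum_range_mul, ← Finset.smul_sum, smul_smul]
  congr 2
  push_cast
  ring

/-- The inner products of the small cells of two cells `p`, `q`. -/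
noncomputable def cellCov (H : HurstIndex) (d m p q k l : ℕ) : ℝ :=
  (((d * m : ℕ) : ℝ) ^ (2 * (H : ℝ)))⁻¹ *
    noiseCorr H (((((p * m + k : ℕ) : ℤ) - (q * m + l : ℕ)).natAbs : ℕ) : ℤ)

/-- The factor (1 + δ²)/2 is 1 or 1/2, hence at most 1. -/
theorem inner_cellDefect_le {d m : ℕ} (hd : 1 ≤ d) (hm : 1 ≤ m) (i j : Fin n) (p q : ℕ) :
    ⟪cellDefect H n d m i j p, cellDefect H n d m i j q⟫_ℝ ≤
      ∑ k ∈ Finset.range m, ∑ l ∈ Finset.range m, ∑ k' ∈ Finset.range m, ∑ l' ∈ Finset.range m,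
        doubleIncr (cellCov H d m p q) k l k' l' ^ 2 := by
  have hdm : 1 ≤ d * m := Nat.mul_pos hd hm
  have h := sum_doubleIncr_sq_nonneg m (cellCov H d m p q)
  rw [cellDefect, cellDefect, inner_diagDefect (x := cellCov H d m p q)
    (δ := if i = j then 1 else 0)]
  · split_ifs <;> linarith
  all_goals
    intro k l
    simp only [inner_cell H n hdm, cellCov, noiseCorr_natAbs, if_true, eq_comm (a := j)]
    try (split_ifs <;> simp)

/-! ### Near and distant cell defects, uniformly in the refinement -/

theorem rpow_four_mul_eq {x : ℝ} (hx : 0 ≤ x) (h : ℝ) :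
    (x ^ (4 * h))⁻¹ = ((x ^ (2 * h))⁻¹) ^ 2 := by
  rw [inv_pow, ← Real.rpow_natCast, ← Real.rpow_mul hx]
  congr 2
  push_cast
  ring

/-- The powers of m cancel: 16m² from the crude bound, 2m · m^{4H-3} from the Toeplitz square sum,
and m^{-4H} from the normalisation of the fine cells. -/
theorem norm_cellDefect_sq_le (hH : 3 / 4 < (H : ℝ)) {d m : ℕ} (hd : 1 ≤ d) (hm : 1 ≤ m)
    (i j : Fin n) (p : ℕ) :
    ‖cellDefect H n d m i j p‖ ^ 2 ≤
      32 * (1 + (4 * (H : ℝ) - 3)⁻¹) * ((d : ℝ) ^ (4 * (H : ℝ)))⁻¹ := by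
  have hm0 : (0 : ℝ) < m := by exact_mod_cast hm
  have hd0 : (0 : ℝ) < d := by exact_mod_cast hd
  rw [← real_inner_self_eq_norm_sq]
  refine ((inner_cellDefect_le H n hd hm i j p p).trans (sum_doubleIncr_sq_le m _)).trans ?_
  have e : ∑ k ∈ Finset.range m, ∑ l ∈ Finset.range m, cellCov H d m p p k l ^ 2 =
      (((d * m : ℕ) : ℝ) ^ (4 * (H : ℝ)))⁻¹ * ∑ k ∈ Finset.range m, ∑ l ∈ Finset.range m,
        noiseCorr H (((k : ℤ) - l).natAbs : ℤ) ^ 2 := by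
    simp only [Finset.mul_sum]
    refine Finset.sum_congr rfl fun k _ => Finset.sum_congr rfl fun l _ => ?_
    rw [cellCov, mul_pow, rpow_four_mul_eq (by positivity)]
    congr 5
    push_cast
    ring
  have h1 := (sum_sum_natAbs_sub_le (fun r => noiseCorr H (r : ℤ) ^ 2) (fun _ => sq_nonneg _) m)
  have h2 := sum_noiseCorr_sq_le H hH hm
  rw [e]
  calc _ ≤ 16 * (m : ℝ) ^ 2 * ((((d * m : ℕ) : ℝ) ^ (4 * (H : ℝ)))⁻¹ *
        (2 * m * ((1 + (4 * (H : ℝ) - 3)⁻¹) * (m : ℝ) ^ (4 * (H : ℝ) - 3)))) := by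
        gcongr
        exact h1.trans (by gcongr)
    _ = _ := by
        push_cast
        rw [Real.mul_rpow hd0.le hm0.le, Real.rpow_sub hm0, show (3 : ℝ) = ((3 : ℕ) : ℝ) by norm_num,
          Real.rpow_natCast]
        have := (Real.rpow_pos_of_pos hm0 (4 * (H : ℝ))).ne'
        have := (Real.rpow_pos_of_pos hd0 (4 * (H : ℝ))).ne'
        push_cast
        field_simp
        ring

/-- Fine cells inside coarse cells at distance r + 2 are between (r+1)m and (r+3)m apart, because
the positions inside a cell differ by less than m. Monotonicity of the correlation turns this into
an interval for the covariance. -/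
theorem inner_cellDefect_le_of_two_le (hH : 3 / 4 < (H : ℝ)) {d m : ℕ} (hd : 1 ≤ d) (hm : 1 ≤ m)
    (i j : Fin n) (p q : ℕ) {r : ℕ} (hr : ((p : ℤ) - q).natAbs = r + 2) :
    ⟪cellDefect H n d m i j p, cellDefect H n d m i j q⟫_ℝ ≤
      4 * (m : ℝ) ^ 4 * (((d * m : ℕ) : ℝ) ^ (4 * (H : ℝ)))⁻¹ *
        (noiseCorr H (((r + 1) * m : ℕ) : ℤ) - noiseCorr H (((r + 3) * m : ℕ) : ℤ)) ^ 2 := by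
  have anti := antitone_noiseCorr H (by linarith)
  refine (inner_cellDefect_le H n hd hm i j p q).trans
    ((sum_doubleIncr_sq_le_of_mem_Icc
      (α := (((d * m : ℕ) : ℝ) ^ (2 * (H : ℝ)))⁻¹ * noiseCorr H (((r + 3) * m : ℕ) : ℤ))
      (β := (((d * m : ℕ) : ℝ) ^ (2 * (H : ℝ)))⁻¹ * noiseCorr H (((r + 1) * m : ℕ) : ℤ)) (fun k hk l hl => ⟨?_, ?_⟩)).trans (le_of_eq ?_))
  · refine mul_le_mul_of_nonneg_left (anti ?_) (by positivity)
    have e : (((p * m + k : ℕ) : ℤ) - (q * m + l : ℕ)) = ((p : ℤ) - q) * m + ((k : ℤ) - l) := by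
      push_cast; ring
    rw [e]
    calc _ ≤ (((p : ℤ) - q) * m).natAbs + ((k : ℤ) - l).natAbs := Int.natAbs_add_le _ _
      _ ≤ (r + 2) * m + m := by
        rw [Int.natAbs_mul, hr, Int.natAbs_natCast]
        omega
      _ = _ := by ring
  · refine mul_le_mul_of_nonneg_left (anti ?_) (by positivity)
    have e : ((p : ℤ) - q) * m =
        (((p * m + k : ℕ) : ℤ) - (q * m + l : ℕ)) + ((l : ℤ) - k) := by
      push_cast; ring
    have h1 := Int.natAbs_add_le (((p * m + k : ℕ) : ℤ) - (q * m + l : ℕ)) ((l : ℤ) - k)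
    rw [← e, Int.natAbs_mul, hr, Int.natAbs_natCast] at h1
    have h2 : (r + 2) * m = (r + 1) * m + m := by ring
    omega
  · rw [rpow_four_mul_eq (by positivity)]
    ring

/-- A bound on the inner products of cell defects, in terms of the distance of the cells. -/
noncomputable def defectBound (H : HurstIndex) (d m : ℕ) : ℕ → ℝ
  | 0 => 32 * (1 + (4 * (H : ℝ) - 3)⁻¹) * ((d : ℝ) ^ (4 * (H : ℝ)))⁻¹
  | 1 => 32 * (1 + (4 * (H : ℝ) - 3)⁻¹) * ((d : ℝ) ^ (4 * (H : ℝ)))⁻¹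
  | r + 2 => 4 * (m : ℝ) ^ 4 * (((d * m : ℕ) : ℝ) ^ (4 * (H : ℝ)))⁻¹ *
        (noiseCorr H (((r + 1) * m : ℕ) : ℤ) - noiseCorr H (((r + 3) * m : ℕ) : ℤ)) ^ 2

theorem defectBound_nonneg (hH : 3 / 4 < (H : ℝ)) (d m r : ℕ) : 0 ≤ defectBound H d m r := by
  have : 0 < 4 * (H : ℝ) - 3 := by linarith
  match r with
  | 0 => rw [defectBound]; positivity
  | 1 => rw [defectBound]; positivity
  | r + 2 => rw [defectBound]; positivity

theorem inner_cellDefect_le_defectBound (hH : 3 / 4 < (H : ℝ)) {d m : ℕ} (hd : 1 ≤ d)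
    (hm : 1 ≤ m) (i j : Fin n) (p q : ℕ) :
    ⟪cellDefect H n d m i j p, cellDefect H n d m i j q⟫_ℝ ≤
      defectBound H d m ((p : ℤ) - q).natAbs := by
  -- Monotonicity gives nothing useful at distance 0 or 1, so Cauchy–Schwarz reduces these cases to
  -- the norms.
  have near : ⟪cellDefect H n d m i j p, cellDefect H n d m i j q⟫_ℝ ≤
      32 * (1 + (4 * (H : ℝ) - 3)⁻¹) * ((d : ℝ) ^ (4 * (H : ℝ)))⁻¹ := by
    have h1 := norm_cellDefect_sq_le H n hH hd hm i j p
    have h2 := norm_cellDefect_sq_le H n hH hd hm i j q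
    have h3 := real_inner_le_norm (cellDefect H n d m i j p) (cellDefect H n d m i j q)
    nlinarith [sq_nonneg (‖cellDefect H n d m i j p‖ - ‖cellDefect H n d m i j q‖)]
  match hr : ((p : ℤ) - q).natAbs with
  | 0 => exact near
  | 1 => exact near
  | r + 2 => exact inner_cellDefect_le_of_two_le H n hH hd hm i j p q hr

/-- The two near values give the 64. The distant ones telescope to twice the squared correlation at
m, at most 2m^{4H-4}, which cancels the prefactor m⁴ · m^{-4H} and gives the 8 = 4 · 2. -/
theorem sum_defectBound_le (hH : 3 / 4 < (H : ℝ)) {d m : ℕ} (hd : 1 ≤ d) (hm : 1 ≤ m) :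
    ∑ r ∈ Finset.range d, defectBound H d m r ≤
      (64 * (1 + (4 * (H : ℝ) - 3)⁻¹) + 8) * ((d : ℝ) ^ (4 * (H : ℝ)))⁻¹ := by
  have hm0 : (0 : ℝ) < m := by exact_mod_cast hm
  have hd0 : (0 : ℝ) < d := by exact_mod_cast hd
  have h1 := sum_sq_sub_le_of_antitone (antitone_noiseCorr H (by linarith))
    (fun k => noiseCorr_nonneg H (by linarith) k) m d
  have h2 : noiseCorr H (m : ℤ) ^ 2 ≤ ((m : ℝ) ^ (2 * (H : ℝ) - 2)) ^ 2 :=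
    pow_le_pow_left₀ (noiseCorr_nonneg H (by linarith) _) (noiseCorr_le_rpow H hm) 2
  have e : ((m : ℝ) ^ (2 * (H : ℝ) - 2)) ^ 2 = (m : ℝ) ^ (4 * (H : ℝ)) / (m : ℝ) ^ 4 := by
    rw [← Real.rpow_natCast, ← Real.rpow_mul hm0.le, ← Real.rpow_natCast (m : ℝ) 4,
      ← Real.rpow_sub hm0]
    congr 1
    push_cast
    ring
  -- Two more nonnegative terms are added so that splitting off r = 0 and r = 1 leaves exactly
  -- `range d`, also for small d.
  calc _ ≤ ∑ r ∈ Finset.range (d + 2), defectBound H d m r :=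
        Finset.sum_le_sum_of_subset_of_nonneg (Finset.range_mono (by omega))
          fun r _ _ => defectBound_nonneg H hH d m r
    _ = 4 * (m : ℝ) ^ 4 * (((d * m : ℕ) : ℝ) ^ (4 * (H : ℝ)))⁻¹ *
          ∑ r ∈ Finset.range d, (noiseCorr H (((r + 1) * m : ℕ) : ℤ) -
            noiseCorr H (((r + 3) * m : ℕ) : ℤ)) ^ 2 +
          2 * (32 * (1 + (4 * (H : ℝ) - 3)⁻¹) * ((d : ℝ) ^ (4 * (H : ℝ)))⁻¹) := by
        rw [Finset.sum_range_succ', Finset.sum_range_succ', Finset.mul_sum]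
        simp only [defectBound]
        ring
    _ ≤ 4 * (m : ℝ) ^ 4 * (((d * m : ℕ) : ℝ) ^ (4 * (H : ℝ)))⁻¹ *
          (2 * ((m : ℝ) ^ (4 * (H : ℝ)) / (m : ℝ) ^ 4)) +
          2 * (32 * (1 + (4 * (H : ℝ) - 3)⁻¹) * ((d : ℝ) ^ (4 * (H : ℝ)))⁻¹) := by
        gcongr
        exact h1.trans (by rw [← e]; linarith)
    _ = _ := by
        push_cast
        rw [Real.mul_rpow hd0.le hm0.le]
        have := (Real.rpow_pos_of_pos hm0 (4 * (H : ℝ))).ne'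
        have := (Real.rpow_pos_of_pos hd0 (4 * (H : ℝ))).ne'
        field_simp
        ring

/-- The constant in the rate of convergence of the kernels. -/
noncomputable def rosenblattConst (H : ℝ) : ℝ := √(32 * (1 + (4 * H - 3)⁻¹) + 4)

theorem rosenblattConst_pos (hH : 3 / 4 < (H : ℝ)) : 0 < rosenblattConst H := by
  have : 0 < 4 * (H : ℝ) - 3 := by linarith
  rw [rosenblattConst]
  positivity

/-- The squared norm is (d/2)² times a Toeplitz sum of at most 2d times the row bound, of order d³ ·
d^{-4H}. The factor (1/4) · 2 turns 64 and 8 into the 32 and 4 of `rosenblattConst`. The absence of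
m is essential. -/
theorem norm_rosenblattApprox_sub_mul_le (hH : 3 / 4 < (H : ℝ)) {d m : ℕ} (hd : 1 ≤ d)
    (hm : 1 ≤ m) (i j : Fin n) :
    ‖rosenblattApprox H n i j d - rosenblattApprox H n i j (d * m)‖ ≤
      rosenblattConst H * (d : ℝ) ^ ((3 - 4 * (H : ℝ)) / 2) := by
  have hd0 : (0 : ℝ) < d := by exact_mod_cast hd
  have hC : 0 < 4 * (H : ℝ) - 3 := by linarith
  refine le_of_sq_le_sq ?_ (by have := rosenblattConst_pos H hH; positivity)
  have h : ‖∑ p ∈ Finset.range d, cellDefect H n d m i j p‖ ^ 2 ≤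
      2 * d * ((64 * (1 + (4 * (H : ℝ) - 3)⁻¹) + 8) * ((d : ℝ) ^ (4 * (H : ℝ)))⁻¹) := by
    rw [← real_inner_self_eq_norm_sq]
    rw [sum_inner]
    simp only [inner_sum]
    calc _ ≤ ∑ p ∈ Finset.range d, ∑ q ∈ Finset.range d, defectBound H d m ((p : ℤ) - q).natAbs :=
          Finset.sum_le_sum fun p _ => Finset.sum_le_sum fun q _ =>
            inner_cellDefect_le_defectBound H n hH hd hm i j p q
      _ ≤ _ := sum_sum_natAbs_sub_le _ (defectBound_nonneg H hH d m) d
      _ ≤ _ := mul_le_mul_of_nonneg_left (sum_defectBound_le H hH hd hm) (by positivity)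
  rw [rosenblattApprox_sub H n hd hm, norm_smul, mul_pow, mul_pow, rosenblattConst,
    Real.sq_sqrt (by positivity), Real.norm_of_nonneg (by positivity)]
  have e : ((d : ℝ) ^ ((3 - 4 * (H : ℝ)) / 2)) ^ 2 = (d : ℝ) ^ 3 * ((d : ℝ) ^ (4 * (H : ℝ)))⁻¹ := by
    rw [← Real.rpow_natCast, ← Real.rpow_mul hd0.le, ← Real.rpow_natCast (d : ℝ) 3,
      ← Real.rpow_neg hd0.le, ← Real.rpow_add hd0]
    congr 1
    push_cast
    ring
  rw [e]
  calc _ ≤ ((d : ℝ) / 2) ^ 2 *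
        (2 * d * ((64 * (1 + (4 * (H : ℝ) - 3)⁻¹) + 8) * ((d : ℝ) ^ (4 * (H : ℝ)))⁻¹)) := by
        gcongr
    _ = _ := by ring

/-! ### From refinements to the limit kernel -/

/-- Neither subdivision need refine the other; both are compared with their common refinement dd'.
-/
theorem norm_rosenblattApprox_sub_le (hH : 3 / 4 < (H : ℝ)) {d d' : ℕ} (hd : 1 ≤ d)
    (hd' : 1 ≤ d') (i j : Fin n) :
    ‖rosenblattApprox H n i j d - rosenblattApprox H n i j d'‖ ≤
      rosenblattConst H * (d : ℝ) ^ ((3 - 4 * (H : ℝ)) / 2) +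
        rosenblattConst H * (d' : ℝ) ^ ((3 - 4 * (H : ℝ)) / 2) := by
  have h1 := norm_rosenblattApprox_sub_mul_le H n hH hd hd' i j
  have h2 := norm_rosenblattApprox_sub_mul_le H n hH hd' hd i j
  rw [mul_comm d' d] at h2
  rw [norm_sub_rev] at h2
  refine le_trans ?_ (add_le_add h1 h2)
  refine le_trans (le_of_eq ?_) (norm_add_le _ _)
  congr 1
  abel

theorem tendsto_rosenblattRate (hH : 3 / 4 < (H : ℝ)) :
    Tendsto (fun d : ℕ => rosenblattConst H * (d : ℝ) ^ ((3 - 4 * (H : ℝ)) / 2)) atTop (𝓝 0) := by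
  have h := (tendsto_rpow_neg_atTop (y := (4 * (H : ℝ) - 3) / 2) (by linarith)).comp
    tendsto_natCast_atTop_atTop
  have := h.const_mul (rosenblattConst H)
  rw [mul_zero] at this
  refine this.congr fun d => ?_
  simp only [Function.comp_apply]
  congr 2
  ring

theorem tendsto_rosenblattApprox (hH : 3 / 4 < (H : ℝ)) (i j : Fin n) :
    Tendsto (rosenblattApprox H n i j) atTop (𝓝 (rosenblattKernel H n i j)) := by
  refine CauchySeq.tendsto_limUnder ?_
  rw [Metric.cauchySeq_iff']
  intro ε hε
  obtain ⟨N, hN⟩ := eventually_atTop.1 ((tendsto_rosenblattRate H hH).eventually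
    (gt_mem_nhds (half_pos hε)))
  refine ⟨max N 1, fun d hd => ?_⟩
  rw [dist_eq_norm]
  refine (norm_rosenblattApprox_sub_le H n hH (le_trans (le_max_right _ _) hd)
    (le_max_right _ _) i j).trans_lt ?_
  have h1 := hN d (le_trans (le_max_left _ _) hd)
  have h2 := hN (max N 1) (le_max_left _ _)
  linarith

/-- Let d' → ∞ in the two-sided estimate; the second term vanishes, so the constant is unchanged. -/
theorem norm_rosenblattApprox_sub_kernel_le (hH : 3 / 4 < (H : ℝ)) {d : ℕ} (hd : 1 ≤ d)
    (i j : Fin n) :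
    ‖rosenblattApprox H n i j d - rosenblattKernel H n i j‖ ≤
      rosenblattConst H * (d : ℝ) ^ ((3 - 4 * (H : ℝ)) / 2) := by
  have h1 := (tendsto_const_nhds (x := rosenblattApprox H n i j d)).sub
    (tendsto_rosenblattApprox H n hH i j)
  have h2 := (tendsto_const_nhds (x := rosenblattConst H *
    (d : ℝ) ^ ((3 - 4 * (H : ℝ)) / 2))).add (tendsto_rosenblattRate H hH)
  rw [add_zero] at h2
  refine le_of_tendsto_of_tendsto h1.norm h2 ?_
  filter_upwards [eventually_ge_atTop 1] with d' hd'
  exact norm_rosenblattApprox_sub_le H n hH hd hd' i j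

end Convergence

/-! ## Laws of Gaussian vectors and norms of double integrals -/

namespace IsIsonormal

variable {E : Type*} [NormedAddCommGroup E] [InnerProductSpace ℝ E]
  {Ω : Type*} [MeasurableSpace Ω] {X : E → Ω → ℝ} {P : Measure Ω}

theorem sum_smul_ae (hX : IsIsonormal X P) {ι : Type*} (s : Finset ι) (c : ι → ℝ) (h : ι → E) :
    X (∑ t ∈ s, c t • h t) =ᵐ[P] fun ω => ∑ t ∈ s, c t * X (h t) ω := by
  classical
  induction s using Finset.induction_on with
  | empty =>
    filter_upwards [hX.smul_ae 0 0] with ω hω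
    simpa using hω
  | insert a s ha ih =>
    filter_upwards [ih, hX.add_ae (c a • h a) (∑ t ∈ s, c t • h t), hX.smul_ae (c a) (h a)]
      with ω h1 h2 h3
    rw [Finset.sum_insert ha, Finset.sum_insert ha, h2, Pi.add_apply, h1, h3]
    rfl

theorem aemeasurable_pi (hX : IsIsonormal X P) {ι : Type*} [Countable ι] (h : ι → E) :
    AEMeasurable (fun ω t => X (h t) ω) P :=
  aemeasurable_pi_lambda _ fun t => hX.gaussian.aemeasurable (h t)

/-- The finite-dimensional laws of isonormal processes are determined by the scalar products. -/
theorem map_pi_eq_map_pi (hX : IsIsonormal X P)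
    {F : Type*} [NormedAddCommGroup F] [InnerProductSpace ℝ F]
    {Ω' : Type*} [MeasurableSpace Ω'] {Y : F → Ω' → ℝ} {P' : Measure Ω'} (hY : IsIsonormal Y P')
    {ι : Type*} [Fintype ι] {h : ι → E} {h' : ι → F} (hh : ∀ s t, ⟪h s, h t⟫_ℝ = ⟪h' s, h' t⟫_ℝ) :
    P.map (fun ω t => X (h t) ω) = P'.map (fun ω t => Y (h' t) ω) := by
  classical
  have := hX.gaussian.isProbabilityMeasure
  have := hY.gaussian.isProbabilityMeasure
  -- Cramér–Wold: each linear functional of the vector is almost surely X(∑ c_t h_t), a centered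
  -- Gaussian whose variance depends only on the Gram matrix.
  refine Measure.ext_of_charFunDual ?_
  funext L
  rw [charFunDual_eq_charFun_map_one, charFunDual_eq_charFun_map_one]
  congr 1
  have hL : ∀ v : ι → ℝ, L v = ∑ t, L (Pi.single t 1) * v t := by
    intro v
    have := LinearMap.pi_apply_eq_sum_univ (L : (ι → ℝ) →ₗ[ℝ] ℝ) v
    simp only [ContinuousLinearMap.coe_coe, smul_eq_mul] at this
    rw [this]
    refine Finset.sum_congr rfl fun t _ => ?_
    rw [mul_comm]
    congr 2
    funext s
    simp [Pi.single_apply, eq_comm]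
  set c : ι → ℝ := fun t => L (Pi.single t 1)
  have e1 : L ∘ (fun ω t => X (h t) ω) =ᵐ[P] X (∑ t, c t • h t) := by
    filter_upwards [hX.sum_smul_ae Finset.univ c h] with ω hω
    rw [hω, Function.comp_apply, hL]
  have e2 : L ∘ (fun ω t => Y (h' t) ω) =ᵐ[P'] Y (∑ t, c t • h' t) := by
    filter_upwards [hY.sum_smul_ae Finset.univ c h'] with ω hω
    rw [hω, Function.comp_apply, hL]
  rw [AEMeasurable.map_map_of_aemeasurable (by fun_prop) (hX.aemeasurable_pi h),
    AEMeasurable.map_map_of_aemeasurable (by fun_prop) (hY.aemeasurable_pi h'),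
    Measure.map_congr e1, Measure.map_congr e2, hX.map_eq, hY.map_eq,
    ← real_inner_self_eq_norm_sq, ← real_inner_self_eq_norm_sq]
  simp only [sum_inner, inner_sum, inner_smul_left, inner_smul_right, hh]

theorem I2_coe (hX : IsIsonormal X P) (t : E ⊗[ℝ] E) :
    hX.I2 (t : UniformSpace.Completion (E ⊗[ℝ] E)) = hX.I2Alg t :=
  (hX.I2Alg.mkContinuous (√2) hX.norm_I2Alg_le).extend_eq
    (e := UniformSpace.Completion.toComplL)
    UniformSpace.Completion.denseRange_coe
    (UniformSpace.Completion.isUniformInducing_coe (E ⊗[ℝ] E)) t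

theorem norm_I2_le (hX : IsIsonormal X P) (f : HilbertSq E) : ‖hX.I2 f‖ ≤ √2 * ‖f‖ := by
  induction f using UniformSpace.Completion.induction_on with
  | hp => exact isClosed_le (by fun_prop) (by fun_prop)
  | ih t =>
    rw [I2_coe, UniformSpace.Completion.norm_coe]
    exact hX.norm_I2Alg_le t

theorem wick_comm (hX : IsIsonormal X P) (a b : E) : hX.wick a b = hX.wick b a := by
  refine Lp.ext ?_
  filter_upwards [hX.wick_coe a b, hX.wick_coe b a] with ω h1 h2
  rw [h1, h2, mul_comm, real_inner_comm]

theorem I2_symTmul_ae (hX : IsIsonormal X P) (a b : E) :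
    hX.I2 (HilbertSq.symTmul a b) =ᵐ[P] fun ω => 2 * (X a ω * X b ω - ⟪a, b⟫_ℝ) := by
  rw [HilbertSq.symTmul_apply, map_add, I2_tmul, I2_tmul, hX.wick_comm b a]
  filter_upwards [Lp.coeFn_add (hX.wick a b) (hX.wick a b), hX.wick_coe a b] with ω h1 h2
  rw [h1, Pi.add_apply, h2]
  ring

end IsIsonormal

/-! ## The rescaled Wishart matrix as a matrix of double integrals -/

/-- The rescaled Wishart matrix as a function of the entries of the data matrix. -/
noncomputable def wishartOf (H : ℝ) (n d : ℕ) (v : Fin n × Fin d → ℝ) : Matrix (Fin n) (Fin n) ℝ :=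
  (d : ℝ) ^ (2 - 2 * H) •
    ((d : ℝ)⁻¹ • (Matrix.of (fun i p => v (i, p)) *
      (Matrix.of fun i p => v (i, p)).transpose) - 1)

theorem continuous_wishartOf (H : ℝ) (n d : ℕ) : Continuous (wishartOf H n d) := by
  have : Continuous fun v : Fin n × Fin d → ℝ =>
      (Matrix.of (fun i p => v (i, p)) : Matrix (Fin n) (Fin d) ℝ) :=
    continuous_matrix fun i p => continuous_apply (i, p)
  unfold wishartOf
  exact (((this.matrix_mul this.matrix_transpose).const_smul (d : ℝ)⁻¹).sub
    continuous_const).const_smul ((d : ℝ) ^ (2 - 2 * H))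

section Coupling

variable {H : HurstIndex} {n : ℕ} {Ω : Type*} [MeasurableSpace Ω] {P : Measure Ω}
  {B : FbmHilbert H n → Ω → ℝ}

open FbmHilbert HilbertSq

/-- The matrix of the double integrals of the approximating kernels. -/
noncomputable def rosenblattApproxMatrix (hB : IsIsonormal B P) (d : ℕ) (ω : Ω) :
    Matrix (Fin n) (Fin n) ℝ :=
  Matrix.of fun i j => hB.I2 (rosenblattApprox H n i j d) ω

theorem I2_rosenblattApprox_ae (hB : IsIsonormal B P) {d : ℕ} (hd : 1 ≤ d) (i j : Fin n) :
    hB.I2 (rosenblattApprox H n i j d) =ᵐ[P] fun ω => (d : ℝ) * ∑ p ∈ Finset.range d,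
      (B (cell H n d i p) ω * B (cell H n d j p) ω -
        if i = j then ((d : ℝ) ^ (2 * (H : ℝ)))⁻¹ else 0) := by
  have hs : ∀ s : Finset ℕ,
      hB.I2 (∑ p ∈ s, symTmul (cell H n d i p) (cell H n d j p)) =ᵐ[P] fun ω => ∑ p ∈ s,
        2 * (B (cell H n d i p) ω * B (cell H n d j p) ω -
          if i = j then ((d : ℝ) ^ (2 * (H : ℝ)))⁻¹ else 0) := by
    intro s
    induction s using Finset.induction_on with
    | empty =>
      simp only [Finset.sum_empty, map_zero]
      exact Lp.coeFn_zero _ _ _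
    | insert a s ha ih =>
      rw [Finset.sum_insert ha, map_add]
      filter_upwards [ih, hB.I2_symTmul_ae (cell H n d i a) (cell H n d j a),
        Lp.coeFn_add (hB.I2 (symTmul (cell H n d i a) (cell H n d j a)))
          (hB.I2 (∑ p ∈ s, symTmul (cell H n d i p) (cell H n d j p)))] with ω h1 h2 h3
      rw [h3, Pi.add_apply, h1, h2, Finset.sum_insert ha, inner_cell H n hd]
      simp [noiseCorr_zero]
  rw [rosenblattApprox_eq, map_smul]
  filter_upwards [hs (Finset.range d), Lp.coeFn_smul ((d : ℝ) / 2)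
    (hB.I2 (∑ p ∈ Finset.range d, symTmul (cell H n d i p) (cell H n d j p)))] with ω h1 h2
  rw [h2, Pi.smul_apply, h1, ← Finset.mul_sum, smul_eq_mul]
  ring

/-- By self-similarity, the rescaled Wishart matrix of the normalised increments of `B` is the
matrix of the double integrals of the approximating kernels. -/
theorem wishartOf_cell_ae (hB : IsIsonormal B P) {d : ℕ} (hd : 1 ≤ d) :
    (fun ω => wishartOf H n d fun t => B ((d : ℝ) ^ (H : ℝ) • cell H n d t.1 t.2) ω) =ᵐ[P]
      rosenblattApproxMatrix hB d := by
  have hd0 : (0 : ℝ) < d := by exact_mod_cast hd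
  have h1 : ∀ᵐ ω ∂P, ∀ i j : Fin n, hB.I2 (rosenblattApprox H n i j d) ω =
      (d : ℝ) * ∑ p ∈ Finset.range d, (B (cell H n d i p) ω * B (cell H n d j p) ω -
        if i = j then ((d : ℝ) ^ (2 * (H : ℝ)))⁻¹ else 0) :=
    ae_all_iff.2 fun i => ae_all_iff.2 fun j => I2_rosenblattApprox_ae hB hd i j
  have h2 : ∀ᵐ ω ∂P, ∀ (i : Fin n) (p : ℕ), B ((d : ℝ) ^ (H : ℝ) • cell H n d i p) ω =
      (d : ℝ) ^ (H : ℝ) * B (cell H n d i p) ω :=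
    ae_all_iff.2 fun i => ae_all_iff.2 fun p => hB.smul_ae _ _
  filter_upwards [h1, h2] with ω h1 h2
  ext i j
  -- The scalings match: d^{2-2H} · d^{-1} · d^{2H} = d is the weight of the products, and d^{2-2H}
  -- = d · (d · d^{-2H}) is the total of the Wick corrections on the diagonal.
  have e1 : (d : ℝ) ^ (2 - 2 * (H : ℝ)) = (d : ℝ) ^ 2 * ((d : ℝ) ^ (2 * (H : ℝ)))⁻¹ := by
    rw [Real.rpow_sub hd0, Real.rpow_two, div_eq_mul_inv]
  have e2 : (d : ℝ) ^ (2 * (H : ℝ)) = (d : ℝ) ^ (H : ℝ) * (d : ℝ) ^ (H : ℝ) := by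
    rw [← Real.rpow_add hd0, two_mul]
  have hp := (Real.rpow_pos_of_pos hd0 (H : ℝ)).ne'
  rw [rosenblattApproxMatrix, Matrix.of_apply, h1, wishartOf, e1, e2]
  simp only [Matrix.smul_apply, Matrix.sub_apply, Matrix.mul_apply, Matrix.transpose_apply,
    Matrix.of_apply, h2, smul_eq_mul, Matrix.one_apply, Finset.sum_sub_distrib, Finset.sum_const,
    Finset.card_range, nsmul_eq_mul]
  rw [Fin.sum_univ_eq_sum_range (fun p => (d : ℝ) ^ (H : ℝ) * B (cell H n d i p) ω *
    ((d : ℝ) ^ (H : ℝ) * B (cell H n d j p) ω))]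
  have e3 : ∑ p ∈ Finset.range d, (d : ℝ) ^ (H : ℝ) * B (cell H n d i p) ω *
      ((d : ℝ) ^ (H : ℝ) * B (cell H n d j p) ω) = (d : ℝ) ^ (H : ℝ) * (d : ℝ) ^ (H : ℝ) *
        ∑ p ∈ Finset.range d, B (cell H n d i p) ω * B (cell H n d j p) ω := by
    rw [Finset.mul_sum]
    exact Finset.sum_congr rfl fun p _ => by ring
  rw [e3]
  split_ifs
  · field_simp
  · field_simp
    simp

/-- The factor d^H normalises the increments to unit variance, so the two Gram matrices agree. -/
theorem map_dataMatrix_eq (hB : IsIsonormal B P) {E : Type*} [NormedAddCommGroup E]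
    [InnerProductSpace ℝ E] {Ω' : Type*} [MeasurableSpace Ω'] {P' : Measure Ω'} {X : E → Ω' → ℝ}
    (hX : IsIsonormal X P') {e : ℕ → ℕ → E} (he : HasCorrelation e (noiseCorr H)) {d : ℕ}
    (hd : 1 ≤ d) :
    P'.map (fun ω (t : Fin n × Fin d) => X (e t.1 t.2) ω) =
      P.map (fun ω (t : Fin n × Fin d) => B ((d : ℝ) ^ (H : ℝ) • cell H n d t.1 t.2) ω) := by
  have hd0 : (0 : ℝ) < d := by exact_mod_cast hd
  refine hX.map_pi_eq_map_pi hB (h := fun t : Fin n × Fin d => e t.1 t.2)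
    (h' := fun t : Fin n × Fin d => (d : ℝ) ^ (H : ℝ) • cell H n d t.1 t.2) fun s t => ?_
  rw [he, inner_smul_left, inner_smul_right, inner_cell H n hd]
  simp only [Fin.val_inj, conj_trivial]
  have e2 : (d : ℝ) ^ (2 * (H : ℝ)) = (d : ℝ) ^ (H : ℝ) * (d : ℝ) ^ (H : ℝ) := by
    rw [← Real.rpow_add hd0, two_mul]
  have hp := (Real.rpow_pos_of_pos hd0 (H : ℝ)).ne'
  rw [e2]
  split_ifs
  · field_simp
  · simp

end Coupling

/-! ## Lipschitz functions of matrices -/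

section Lipschitz

variable {n : ℕ}

theorem hsNorm_sq (A : Matrix (Fin n) (Fin n) ℝ) : hsNorm A ^ 2 = ∑ i, ∑ j, A i j ^ 2 :=
  Real.sq_sqrt (Finset.sum_nonneg fun _ _ => Finset.sum_nonneg fun _ _ => sq_nonneg _)

theorem hsNorm_nonneg (A : Matrix (Fin n) (Fin n) ℝ) : 0 ≤ hsNorm A := Real.sqrt_nonneg _

theorem hsNorm_pos {A : Matrix (Fin n) (Fin n) ℝ} (hA : A ≠ 0) : 0 < hsNorm A := by
  refine (hsNorm_nonneg A).lt_of_ne fun h => hA ?_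
  have h1 := hsNorm_sq A
  rw [← h, eq_comm] at h1
  ext i j
  have h2 := (Finset.sum_eq_zero_iff_of_nonneg fun i _ => Finset.sum_nonneg fun j _ =>
    sq_nonneg (A i j)).1 (h1.trans (by norm_num)) i (Finset.mem_univ i)
  have h3 := (Finset.sum_eq_zero_iff_of_nonneg fun j _ => sq_nonneg (A i j)).1 h2 j
    (Finset.mem_univ j)
  simpa using h3

theorem hsNorm_le_sum_abs (A : Matrix (Fin n) (Fin n) ℝ) : hsNorm A ≤ ∑ i, ∑ j, |A i j| := by
  rw [hsNorm, ← Finset.sum_product', ← Finset.sum_product']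
  exact (Real.sqrt_le_sqrt (Finset.sum_le_sum fun x _ => (sq_abs (A x.1 x.2)).ge)).trans
    ((Real.sqrt_le_sqrt (Finset.sum_sq_le_sq_sum_of_nonneg
      fun x _ => abs_nonneg (A x.1 x.2))).trans_eq
        (Real.sqrt_sq (Finset.sum_nonneg fun x _ => abs_nonneg (A x.1 x.2))))

theorem abs_sub_le_hsNorm {g : Matrix (Fin n) (Fin n) ℝ → ℝ} (hg : lipNorm g ≤ 1)
    (A C : Matrix (Fin n) (Fin n) ℝ) : |g A - g C| ≤ hsNorm (A - C) := by
  by_cases h : A = C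
  · simp [h, hsNorm_nonneg]
  · have h1 : ENNReal.ofReal (|g A - g C| / hsNorm (A - C)) ≤ 1 :=
      (le_iSup₂_of_le (f := fun A C => ⨆ _ : A ≠ C,
        ENNReal.ofReal (|g A - g C| / hsNorm (A - C))) A C (le_iSup_of_le h le_rfl)).trans hg
    rw [ENNReal.ofReal_le_one, div_le_one (hsNorm_pos (sub_ne_zero.2 h))] at h1
    exact h1

/-- Matrices carry the product topology here, so the Hilbert–Schmidt norm is dominated by the sum of
the absolute entries, which is visibly continuous. -/
theorem continuous_of_lipNorm_le {g : Matrix (Fin n) (Fin n) ℝ → ℝ} (hg : lipNorm g ≤ 1) :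
    Continuous g := by
  refine continuous_iff_continuousAt.2 fun A => ?_
  rw [ContinuousAt, tendsto_iff_dist_tendsto_zero]
  have hc : Continuous fun C : Matrix (Fin n) (Fin n) ℝ => ∑ i, ∑ j, |(C - A) i j| := by
    refine continuous_finsetSum _ fun i _ => continuous_finsetSum _ fun j _ => ?_
    exact ((continuous_id.matrix_elem i j).sub continuous_const).abs
  have h0 : Tendsto (fun C : Matrix (Fin n) (Fin n) ℝ => ∑ i, ∑ j, |(C - A) i j|) (𝓝 A) (𝓝 0) := by
    have := hc.tendsto A
    simpa using this
  refine squeeze_zero (fun _ => dist_nonneg) (fun C => ?_) h0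
  rw [Real.dist_eq]
  exact (abs_sub_le_hsNorm hg C A).trans (hsNorm_le_sum_abs _)

theorem integrable_of_lipNorm_le {g : Matrix (Fin n) (Fin n) ℝ → ℝ} (hg : lipNorm g ≤ 1)
    {Ω : Type*} [MeasurableSpace Ω] {P : Measure Ω} [IsFiniteMeasure P]
    {Y : Ω → Matrix (Fin n) (Fin n) ℝ} (hY : ∀ i j, Integrable (fun ω => Y ω i j) P) :
    Integrable (fun ω => g (Y ω)) P := by
  have hm : AEMeasurable (fun ω i j => Y ω i j : Ω → Fin n → Fin n → ℝ) P :=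
    aemeasurable_pi_lambda _ fun i => aemeasurable_pi_lambda _ fun j => (hY i j).aemeasurable
  have hm' : AEStronglyMeasurable (fun ω => g (Y ω)) P :=
    (continuous_of_lipNorm_le hg : Continuous (fun A : Fin n → Fin n → ℝ => g A)
      ).comp_aestronglyMeasurable hm.aestronglyMeasurable
  have hi : Integrable (fun ω => |g 0| + ∑ i, ∑ j, |Y ω i j|) P :=
    (integrable_const _).add (integrable_finsetSum _ fun i _ => integrable_finsetSum _ fun j _ =>
      (hY i j).abs)
  refine hi.mono' hm' (Eventually.of_forall fun ω => ?_)
  have h1 := (abs_sub_le_hsNorm hg (Y ω) 0).trans (hsNorm_le_sum_abs _)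
  rw [sub_zero] at h1
  have h2 := abs_sub_abs_le_abs_sub (g (Y ω)) (g 0)
  rw [Real.norm_eq_abs]
  linarith

end Lipschitz

/-! ## The Wasserstein bound -/

section Wasserstein

variable {H : HurstIndex} {n : ℕ} {Ω : Type*} [MeasurableSpace Ω] {P : Measure Ω}
  {B : FbmHilbert H n → Ω → ℝ}

theorem integral_sq_Lp (f : Lp ℝ 2 P) : ∫ ω, f ω ^ 2 ∂P = ‖f‖ ^ 2 := by
  rw [← real_inner_self_eq_norm_sq, L2.inner_def]
  refine integral_congr_ae (Eventually.of_forall fun ω => ?_)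
  simp [sq]

theorem integrable_sq_Lp (f : Lp ℝ 2 P) : Integrable (fun ω => f ω ^ 2) P :=
  (Lp.memLp f).integrable_sq

/-- The expectations of a Lipschitz function of two matrices of double integrals are close when
the kernels are close. -/
theorem integral_sub_integral_le (hB : IsIsonormal B P) {f f' : Fin n → Fin n →
    HilbertSq (FbmHilbert H n)} {ε : ℝ} (hn : 1 ≤ n) (hε : 0 < ε)
    (hf : ∀ i j, ‖f i j - f' i j‖ ≤ ε) {g : Matrix (Fin n) (Fin n) ℝ → ℝ} (hg : lipNorm g ≤ 1)
    (hi : Integrable (fun ω => g (Matrix.of fun i j => hB.I2 (f i j) ω)) P)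
    (hi' : Integrable (fun ω => g (Matrix.of fun i j => hB.I2 (f' i j) ω)) P) :
    ∫ ω, g (Matrix.of fun i j => hB.I2 (f i j) ω) ∂P -
      ∫ ω, g (Matrix.of fun i j => hB.I2 (f' i j) ω) ∂P ≤ √2 * ε * n := by
  have := hB.gaussian.isProbabilityMeasure
  have hn0 : (0 : ℝ) < n := by exact_mod_cast hn
  set c : ℝ := √2 * ε * n with hc
  have hc0 : 0 < c := by positivity
  have hsub : ∀ᵐ ω ∂P, ∀ i j, hB.I2 (f i j - f' i j) ω = hB.I2 (f i j) ω - hB.I2 (f' i j) ω := by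
    refine ae_all_iff.2 fun i => ae_all_iff.2 fun j => ?_
    rw [map_sub]
    exact Lp.coeFn_sub _ _
  have int : Integrable (fun ω => ∑ i, ∑ j, hB.I2 (f i j - f' i j) ω ^ 2) P :=
    integrable_finsetSum _ fun i _ => integrable_finsetSum _ fun j _ => integrable_sq_Lp _
  have val : ∫ ω, ∑ i, ∑ j, hB.I2 (f i j - f' i j) ω ^ 2 ∂P ≤ c ^ 2 := by
    rw [integral_finsetSum _ fun i _ => integrable_finsetSum _ fun j _ => integrable_sq_Lp _]
    calc _ ≤ ∑ _i : Fin n, ∑ _j : Fin n, (√2 * ε) ^ 2 := by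
          refine Finset.sum_le_sum fun i _ => ?_
          rw [integral_finsetSum _ fun j _ => integrable_sq_Lp _]
          refine Finset.sum_le_sum fun j _ => ?_
          rw [integral_sq_Lp]
          refine pow_le_pow_left₀ (norm_nonneg _) ((hB.norm_I2_le _).trans ?_) 2
          exact mul_le_mul_of_nonneg_left (hf i j) (by positivity)
      _ = c ^ 2 := by
          simp only [Finset.sum_const, Finset.card_univ, Fintype.card_fin, nsmul_eq_mul, hc]
          ring
  rw [← integral_sub hi hi']
  -- Instead of Jensen's inequality, s ≤ s²/(2c) + c/2 is integrated. With c the bound on the L²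
  -- norm, the two halves add up to c.
  calc _ ≤ ∫ ω, ((2 * c)⁻¹ * ∑ i, ∑ j, hB.I2 (f i j - f' i j) ω ^ 2 + c / 2) ∂P := by
        refine integral_mono_ae (hi.sub hi') ((int.const_mul _).add (integrable_const _)) ?_
        filter_upwards [hsub] with ω hω
        have h1 := (le_abs_self _).trans (abs_sub_le_hsNorm hg
          (Matrix.of fun i j => hB.I2 (f i j) ω) (Matrix.of fun i j => hB.I2 (f' i j) ω))
        have h2 := hsNorm_sq ((Matrix.of fun i j => hB.I2 (f i j) ω) -
          (Matrix.of fun i j => hB.I2 (f' i j) ω))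
        simp only [Matrix.sub_apply, Matrix.of_apply, ← hω] at h2
        rw [← h2]
        refine h1.trans ?_
        set s := hsNorm ((Matrix.of fun i j => hB.I2 (f i j) ω) -
          (Matrix.of fun i j => hB.I2 (f' i j) ω))
        have h3 : (2 * c)⁻¹ * s ^ 2 + c / 2 - s = (2 * c)⁻¹ * (s - c) ^ 2 := by
          field_simp
          ring
        have h4 : 0 ≤ (2 * c)⁻¹ * (s - c) ^ 2 := by positivity
        linarith
    _ = (2 * c)⁻¹ * ∫ ω, ∑ i, ∑ j, hB.I2 (f i j - f' i j) ω ^ 2 ∂P + c / 2 := by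
        rw [integral_add (int.const_mul _) (integrable_const _), integral_const_mul]
        simp
    _ ≤ (2 * c)⁻¹ * c ^ 2 + c / 2 := by gcongr
    _ = c := by field_simp; ring

theorem integrable_lip_I2 (hB : IsIsonormal B P) (f : Fin n → Fin n → HilbertSq (FbmHilbert H n))
    {g : Matrix (Fin n) (Fin n) ℝ → ℝ} (hg : lipNorm g ≤ 1) :
    Integrable (fun ω => g (Matrix.of fun i j => hB.I2 (f i j) ω)) P := by
  have := hB.gaussian.isProbabilityMeasure
  exact integrable_of_lipNorm_le hg fun i j => (Lp.memLp (hB.I2 (f i j))).integrable (by norm_num)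

/-- Equality of laws moves the Wishart matrix onto the space of B, where it can be compared pathwise
with the limit. Integrability is moved along with the expectation, since `expDiff` is infinite
without it. -/
theorem dWass_rescaledWishart_le (hH : 3 / 4 < (H : ℝ)) (hB : IsIsonormal B P) {E : Type*}
    [NormedAddCommGroup E] [InnerProductSpace ℝ E] {Ω' : Type*} [MeasurableSpace Ω']
    {P' : Measure Ω'} {X : E → Ω' → ℝ} (hX : IsIsonormal X P') {e : ℕ → ℕ → E}
    (he : HasCorrelation e (noiseCorr H)) {d : ℕ} (hn : 1 ≤ n) (hd : 1 ≤ d) :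
    dWass P' (rescaledWishart H X e n d) P (rosenblattWishart hB) ≤
      ENNReal.ofReal (√2 * rosenblattConst H * n * (d : ℝ) ^ ((3 - 4 * (H : ℝ)) / 2)) := by
  have hd0 : (0 : ℝ) < d := by exact_mod_cast hd
  refine iSup₂_le fun g hg => ?_
  have hgc : Continuous fun v => g (wishartOf H n d v) :=
    (continuous_of_lipNorm_le hg).comp (continuous_wishartOf H n d)
  have mX := hX.aemeasurable_pi fun t : Fin n × Fin d => e t.1 t.2
  have mB := hB.aemeasurable_pi fun t : Fin n × Fin d =>
    (d : ℝ) ^ (H : ℝ) • FbmHilbert.cell H n d t.1 t.2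
  have law := map_dataMatrix_eq hB hX he hd
  have hae : (fun ω => g (wishartOf H n d fun t =>
      B ((d : ℝ) ^ (H : ℝ) • FbmHilbert.cell H n d t.1 t.2) ω)) =ᵐ[P]
      fun ω => g (rosenblattApproxMatrix hB d ω) := by
    filter_upwards [wishartOf_cell_ae hB hd] with ω hω
    rw [hω]
  have i1 := integrable_lip_I2 hB (fun i j => rosenblattApprox H n i j d) hg
  have i2 := integrable_lip_I2 hB (fun i j => rosenblattKernel H n i j) hg
  have i3 : Integrable (fun ω => g (rescaledWishart H X e n d ω)) P' := by
    have h1 : Integrable (fun v => g (wishartOf H n d v))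
        (P'.map fun ω (t : Fin n × Fin d) => X (e t.1 t.2) ω) := by
      rw [law, integrable_map_measure hgc.aestronglyMeasurable mB]
      exact (integrable_congr hae).2 i1
    exact (integrable_map_measure hgc.aestronglyMeasurable mX).1 h1
  have e1 : ∫ ω, g (rescaledWishart H X e n d ω) ∂P' =
      ∫ ω, g (rosenblattApproxMatrix hB d ω) ∂P := by
    have h1 := integral_map mX hgc.aestronglyMeasurable
    have h2 := integral_map mB hgc.aestronglyMeasurable
    rw [law, h2, integral_congr_ae hae] at h1
    exact h1.symm
  rw [expDiff, if_pos ⟨i3, i2⟩, e1]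
  refine ENNReal.ofReal_le_ofReal ?_
  have hε : 0 < rosenblattConst H * (d : ℝ) ^ ((3 - 4 * (H : ℝ)) / 2) :=
    mul_pos (rosenblattConst_pos H hH) (Real.rpow_pos_of_pos hd0 _)
  refine (integral_sub_integral_le hB hn hε
    (fun i j => norm_rosenblattApprox_sub_kernel_le H n hH hd i j) hg i1 i2).trans (le_of_eq ?_)
  ring

theorem dFM_le_dWass {Ω' : Type*} [MeasurableSpace Ω'] (P : Measure Ω)
    (X : Ω → Matrix (Fin n) (Fin n) ℝ) (P' : Measure Ω') (Y : Ω' → Matrix (Fin n) (Fin n) ℝ) :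
    dFM P X P' Y ≤ dWass P X P' Y :=
  iSup₂_le fun g hg => le_iSup₂_of_le g (le_add_self.trans hg) le_rfl

end Wasserstein

/-! ### The main theorem -/

theorem theorem2 (H : HurstIndex) (hH : 3 / 4 < (H : ℝ)) :
    -- the limit kernels defining the Rosenblatt-Wishart matrix exist
    (∀ (n : ℕ) (i j : Fin n),
      Tendsto (rosenblattApprox H n i j) atTop (𝓝 (rosenblattKernel H n i j))) ∧
    -- the bound in Wasserstein distance
    (∃ c : ℝ, 0 < c ∧ ∀ (n d : ℕ), 1 ≤ n → 1 ≤ d →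
      ∀ (E : Type*) [NormedAddCommGroup E] [InnerProductSpace ℝ E] [CompleteSpace E]
        (Ω : Type*) [MeasurableSpace Ω] (P : Measure Ω) (X : E → Ω → ℝ)
        (_hX : IsIsonormal X P) (e : ℕ → ℕ → E) (_he : HasCorrelation e (noiseCorr H))
        (Ω' : Type*) [MeasurableSpace Ω'] (P' : Measure Ω') (B : FbmHilbert H n → Ω' → ℝ)
        (hB : IsIsonormal B P'),
        dWass P (rescaledWishart H X e n d) P' (rosenblattWishart hB) ≤
          ENNReal.ofReal (c * n * (d : ℝ) ^ ((3 - 4 * (H : ℝ)) / 2))) ∧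
    -- closeness of the two matrix ensembles
    (∀ (E : Type*) [NormedAddCommGroup E] [InnerProductSpace ℝ E] [CompleteSpace E]
        (Ω : Type*) [MeasurableSpace Ω] (P : Measure Ω) (X : E → Ω → ℝ)
        (_hX : IsIsonormal X P) (e : ℕ → ℕ → E) (_he : HasCorrelation e (noiseCorr H))
        (Ω' : ℕ → Type*) [∀ n, MeasurableSpace (Ω' n)] (P' : ∀ n, Measure (Ω' n))
        (B : ∀ n, FbmHilbert H n → Ω' n → ℝ) (hB : ∀ n, IsIsonormal (B n) (P' n)),
        IsPhiClose (fun n d => ENNReal.ofReal ((n : ℝ) ^ 2 * (d : ℝ) ^ (3 - 4 * (H : ℝ))))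
          (fun _ _ => P) (fun n d => rescaledWishart H X e n d)
          (fun n _ => P' n) (fun n _ => rosenblattWishart (hB n))) := by
  have hK : 0 < √2 * rosenblattConst H := mul_pos (by positivity) (rosenblattConst_pos H hH)
  refine ⟨fun n i j => tendsto_rosenblattApprox H n hH i j, ⟨_, hK, ?_⟩, ?_⟩
  · intro n d hn hd E _ _ _ Ω _ P X hX e he Ω' _ P' B hB
    exact dWass_rescaledWishart_le hH hB hX he hn hd
  · intro E _ _ _ Ω _ P X hX e he Ω' _ P' B hB
    -- The Wasserstein bound is a constant times the square root of φ(n, d), so φ → 0 suffices; n, d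
    -- → ∞ serves only to have n, d ≥ 1 eventually.
    have h0 : Tendsto (fun x : ℝ≥0∞ => ENNReal.ofReal (√2 * rosenblattConst H) * x ^ (1 / 2 : ℝ))
        (𝓝 0) (𝓝 0) := by
      have h1 : Tendsto (fun x : ℝ≥0∞ => x ^ (1 / 2 : ℝ)) (𝓝 0) (𝓝 0) := by
        have := (ENNReal.continuous_rpow_const (y := (1 / 2 : ℝ))).tendsto 0
        rwa [ENNReal.zero_rpow_of_pos (by norm_num)] at this
      have := ENNReal.Tendsto.const_mul (a := ENNReal.ofReal (√2 * rosenblattConst H)) h1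
        (Or.inr ENNReal.ofReal_ne_top)
      rwa [mul_zero] at this
    have h1 := h0.comp ((tendsto_comap (f := fun q : ℕ × ℕ =>
      ENNReal.ofReal ((q.1 : ℝ) ^ 2 * (q.2 : ℝ) ^ (3 - 4 * (H : ℝ)))) (x := 𝓝 0)).mono_left
        (inf_le_right (a := (atTop ×ˢ atTop : Filter (ℕ × ℕ)))))
    refine tendsto_of_tendsto_of_tendsto_of_le_of_le' tendsto_const_nhds h1
      (Eventually.of_forall fun _ => zero_le) ?_
    have hpos : ∀ᶠ q : ℕ × ℕ in atTop ×ˢ atTop, 1 ≤ q.1 ∧ 1 ≤ q.2 :=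
      (eventually_ge_atTop 1).prod_mk (eventually_ge_atTop 1)
    filter_upwards [hpos.filter_mono inf_le_left] with q hq
    have hq1 : (0 : ℝ) < q.1 := by exact_mod_cast hq.1
    have hq2 : (0 : ℝ) < q.2 := by exact_mod_cast hq.2
    refine ((dFM_le_dWass _ _ _ _).trans
      (dWass_rescaledWishart_le hH (hB q.1) hX he hq.1 hq.2)).trans (le_of_eq ?_)
    rw [Function.comp_apply, ENNReal.ofReal_rpow_of_nonneg (by positivity) (by norm_num),
      ← ENNReal.ofReal_mul hK.le, Real.mul_rpow (by positivity) (by positivity),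
      ← Real.sqrt_eq_rpow, Real.sqrt_sq hq1.le, ← Real.rpow_mul hq2.le]
    congr 1
    rw [mul_assoc]
    congr 3
    ring
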